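/- **Theorem 2.** For $n\ge 1$ consider the Curie-Weiss model ($p=2$) on $\{-1,1\}^n$, $$\mathbb P_{\beta}(\boldsymbol x)\;\propto\;\exp\Big\{\beta n^{-1}\sum_{1\le i,j\le n}x_ix_j\Big\},\qquad \bar x=\frac1n\sum_{i=1}^n x_i .$$ Let $\hat\beta_{ML}$ be the maximum likelihood estimator of $\beta\in\mathbb R$, and let $\hat\beta_{MPL}$ be the maximum pseudolikelihood estimator, in either of the two forms: the closed form $\hat\beta_{MPL}=\eta_2(\bar X)$, where $\eta_2(t)=\frac{\tanh^{-1}(t)}{2t}$ for $t\neq0$ and $\eta_2(0)=0$; or the exact maximizer over $\beta\in\mathbb R$ of $\prod_{i=1}^n\mathbb P_\beta(X_i\mid (X_j)_{j\ne i})$. (Estimators may take the values $\pm\infty$; in particular $\eta_2(\pm1)=+\infty$.) For $x\in[-1,1]$ put $$H_{\beta}(x)=\beta x^2-\tfrac12\{(1+x)\log(1+x)+(1-x)\log(1-x)\},$$ let $\beta^*(2)=\sup\{\beta\ge0:\sup_{[-1,1]}H_\beta=0\}$ $(=\tfrac12)$, and for $\beta>\beta^*(2)$ let $m_*(\beta)$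 be the unique positive global maximizer of $H_\beta$. For testing $\beta=\beta_0$ against larger values with $T_n=\sqrt n(\hat\beta-\beta_0)$, large values being significant, let $L_n=1-F_{T_n,\beta_0}(T_n)$ be the p-value, where $F_{T_n,\beta_0}$ is the distribution function of $T_n$ under $\mathbb P_{\beta_0}$. The (weak) Bahadur slope of the test at $\beta$ is the number $c$ such that $\frac1n\log L_n\to-\frac c2$ in $\mathbb P_\beta$-probability; for $\delta\in(0,1)$ the asymptotic optimal sample size is $N^*(\delta)=-2\log(\delta)/c$; and the Bahadur asymptotic relative efficiency of two tests is the ratio of their slopes. Then for all $\beta>\beta_0>\beta^*(2)$ the Bahadur slopes of the tests based on $\hat\beta_{MPL}$ (in either form) and on $\hat\beta_{ML}$ exist and are respectively $$c_{MPL}=2\Big(\sup_{[-1,1]}H_{\beta_0}-\sup_{x\in[-1,1]:\,\eta_2(x)>\beta}H_{\beta_0}(x)\Big),\qquad c_{ML}=2\Big(\sup_{[-1,1]}H_{\beta_0}-\sup_{m_*(\beta)<x\le1}H_{\beta_0}(x)\Big);$$ they are positive and equal, $c_{MPL}=c_{ML}$. Consequently $N^*_{MPL}(\delta)=N^*_{ML}(\delta)$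 for every $\delta\in(0,1)$, and the Bahadur asymptotic relative efficiency is $\mathrm{eff}(\hat\beta_{ML},\hat\beta_{MPL};\beta_0,\beta)=c_{ML}/c_{MPL}=1$. -/

import Mathlib

/-! # The tensor Curie-Weiss model, its likelihood-type estimators and their Bahadur slopes -/

noncomputable section

namespace CurieWeiss

open Filter Topology

/-- Spin configurations: points of `{-1,1}^n`. -/
abbrev Config (n : ℕ) : Type := Fin n → ℤˣ

/-- The `i`-th coordinate of a configuration, as a real number. -/
def spin {n : ℕ} (x : Config n) (i : Fin n) : ℝ := ((x i : ℤ) : ℝ)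

/-- Average magnetization `x̄ = n⁻¹ ∑ xᵢ`. -/
def avg {n : ℕ} (x : Config n) : ℝ := (n : ℝ)⁻¹ * ∑ i, spin x i

/-- The sufficient statistic `n^{1-p} ∑_{1 ≤ i₁,…,i_p ≤ n} x_{i₁} ⋯ x_{i_p}`. -/
def hamiltonian (p n : ℕ) (x : Config n) : ℝ :=
  (n : ℝ) ^ (1 - (p : ℤ)) * ∑ i : Fin p → Fin n, ∏ j, spin x (i j)

/-- The normalizing constant `Z_n(β,p)`. -/
def partitionZ (β : ℝ) (p n : ℕ) : ℝ :=
  ((2 : ℝ) ^ n)⁻¹ * ∑ x : Config n, Real.exp (β * hamiltonian p n x)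

/-- The probability mass function `P_{β,p}` on `{-1,1}^n`. -/
def pmf (β : ℝ) (p n : ℕ) (x : Config n) : ℝ :=
  Real.exp (β * hamiltonian p n x) / ((2 : ℝ) ^ n * partitionZ β p n)

/-- The probability of an event under `P_{β,p}`. -/
def prob (β : ℝ) (p n : ℕ) (A : Set (Config n)) : ℝ :=
  ∑ x : Config n, A.indicator (pmf β p n) x

/-- The conditional probability `P_{β,p}(Xᵢ = xᵢ | Xⱼ = xⱼ for all j ≠ i)`. -/
def condProb (β : ℝ) (p n : ℕ) (x : Config n) (i : Fin n) : ℝ :=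
  pmf β p n x / (pmf β p n (Function.update x i 1) + pmf β p n (Function.update x i (-1)))

/-- The pseudolikelihood `∏ᵢ P_{β,p}(Xᵢ | (Xⱼ)_{j ≠ i})`. -/
def pseudolikelihood (p n : ℕ) (x : Config n) (β : ℝ) : ℝ :=
  ∏ i, condProb β p n x i

/-- `b` maximizes `L` over the extended real line: an infinite `b` is a maximizer when `L`
tends at `b` to an upper bound of all its values. -/
def IsMaximizer (L : ℝ → ℝ) (b : EReal) : Prop :=
  (∃ r : ℝ, b = (r : EReal) ∧ ∀ s, L s ≤ L r) ∨
  (b = ⊤ ∧ ∃ l : ℝ, Tendsto L atTop (𝓝 l) ∧ ∀ s, L s ≤ l) ∨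
  (b = ⊥ ∧ ∃ l : ℝ, Tendsto L atBot (𝓝 l) ∧ ∀ s, L s ≤ l)

/-- The maximizer of `L` (in the extended real line). -/
def argMax (L : ℝ → ℝ) : EReal := Classical.epsilon (IsMaximizer L)

/-- The maximum likelihood estimator. -/
def mle (p n : ℕ) (x : Config n) : EReal := argMax fun β => pmf β p n x

/-- The maximum pseudolikelihood estimator, as the exact maximizer of the pseudolikelihood. -/
def mpleArgMax (p n : ℕ) (x : Config n) : EReal := argMax (pseudolikelihood p n x)

/-- `tanh⁻¹` on `[-1,1]`, with the values `±∞` at `±1`. -/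
def artanhExt (t : ℝ) : EReal :=
  if t = 1 then ⊤ else if t = -1 then ⊥ else ((Real.artanh t : ℝ) : EReal)

/-- `η_p(t) = p⁻¹ t^{1-p} tanh⁻¹ t` for `t ≠ 0`, and `η_p(0) = 0`. -/
def eta (p : ℕ) (t : ℝ) : EReal :=
  if t = 0 then 0 else (((p : ℝ)⁻¹ * t ^ (1 - (p : ℤ)) : ℝ) : EReal) * artanhExt t

/-- The maximum pseudolikelihood estimator in closed form, `η_p(x̄)`. -/
def mple (p n : ℕ) (x : Config n) : EReal := eta p (avg x)

/-- The test statistic `T_n = √n (β̂ - β₀)`; large values are significant. -/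
def testStat (est : (n : ℕ) → Config n → EReal) (β₀ : ℝ) (n : ℕ) (x : Config n) : EReal :=
  ((Real.sqrt n : ℝ) : EReal) * (est n x - (β₀ : EReal))

/-- The p-value `L_n = 1 - F_{T_n,β₀}(T_n)`, where `F_{T_n,β₀}` is the distribution function of
`T_n` under the null hypothesis `β = β₀`. -/
def pValue (est : (n : ℕ) → Config n → EReal) (p : ℕ) (β₀ : ℝ) (n : ℕ) (x : Config n) : ℝ :=
  1 - prob β₀ p n {y | testStat est β₀ n y ≤ testStat est β₀ n x}

/-- `c` is the (weak) Bahadur slope at the alternative `β` of the test of `β = β₀` based on the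
estimator `est`: `n⁻¹ log L_n → -c/2` in `P_{β,p}`-probability. (Where `L_n = 0` the logarithm
is `-∞`, so such configurations do not count as close to the limit.) -/
def IsBahadurSlope (est : (n : ℕ) → Config n → EReal) (p : ℕ) (β₀ β c : ℝ) : Prop :=
  ∀ ε : ℝ, 0 < ε →
    Tendsto (fun n : ℕ => prob β p n
      {x | 0 < pValue est p β₀ n x ∧ |(n : ℝ)⁻¹ * Real.log (pValue est p β₀ n x) - -(c / 2)| < ε})
      atTop (𝓝 1)

/-- `H_{β,p}(x) = β x^p - ½ {(1+x) log (1+x) + (1-x) log (1-x)}` on `[-1,1]`. -/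
def H (β : ℝ) (p : ℕ) (x : ℝ) : ℝ :=
  β * x ^ p - ((1 + x) * Real.log (1 + x) + (1 - x) * Real.log (1 - x)) / 2

/-- `sup_{x ∈ [-1,1]} H_{β,p}(x)`. -/
def supH (β : ℝ) (p : ℕ) : ℝ := sSup (H β p '' Set.Icc (-1) 1)

/-- The estimation threshold `β^*(p)`. -/
def betaStar (p : ℕ) : ℝ := sSup {β : ℝ | 0 ≤ β ∧ supH β p = 0}

/-- The positive global maximizer `m_*(β,p)` of `H_{β,p}` on `[-1,1]`. -/
def mStar (β : ℝ) (p : ℕ) : ℝ :=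
  Classical.epsilon fun m : ℝ => 0 < m ∧ m ≤ 1 ∧ ∀ y ∈ Set.Icc (-1 : ℝ) 1, H β p y ≤ H β p m

/-- `c_MPL(β₀,β,p) = 2 (sup_{[-1,1]} H_{β₀,p} - sup_{η_p⁻¹((β,∞])} H_{β₀,p})`. -/
def slopeMPL (β₀ β : ℝ) (p : ℕ) : ℝ :=
  2 * (supH β₀ p - sSup (H β₀ p '' {x | x ∈ Set.Icc (-1 : ℝ) 1 ∧ (β : EReal) < eta p x}))

/-- `c_ML(β₀,β,p) = 2 (sup_{[-1,1]} H_{β₀,p} - sup_{m_*(β,p) < x ≤ 1} H_{β₀,p}(x))`. -/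
def slopeML (β₀ β : ℝ) (p : ℕ) : ℝ :=
  2 * (supH β₀ p - sSup (H β₀ p '' Set.Ioc (mStar β p) 1))

/-- The asymptotic optimal sample size `-2 log δ / c` of a test with Bahadur slope `c`. -/
def optimalSampleSize (δ c : ℝ) : ℝ := -(2 * Real.log δ) / c

/-- Bahadur asymptotic relative efficiency of two tests with slopes `c₁` and `c₂`. -/
def bahadurARE (c₁ c₂ : ℝ) : ℝ := c₁ / c₂

end CurieWeiss

end

/-!
With `p = 2` the sufficient statistic is `n x̄ ^ 2`, so everything depends on the configuration
through `|x̄|` only. Three facts give the theorem.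

*The rate function.* `H β` is even, and on `(0, 1)` its derivative `2βt - artanh t` is positive or
negative according as `betaOf t = artanh t / (2t)` is below or above `β`. As `betaOf` increases
strictly from `1/2` to `∞`, every `β > 1/2` is `betaOf m` for a unique `m ∈ (0, 1)`; this `m` is
`mStar β`, and `H β` increases on `[0, m]` and decreases on `[m, 1]`. It follows that
`β < eta 2 x ↔ m < |x|` on `[-1, 1]`, so that the suprema in `slopeMPL` and `slopeML`
range over the same values and both slopes equal `2 (H β₀ m₀ - H β₀ m) > 0` (`slopeML_betaOf`, `slopeMPL_eq_slopeML`).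

*Large deviations of `x̄`.* A magnetization `t` is taken by at most `2 ^ n exp (n H₀(t))`
configurations, because the product measure of mean `t` gives each of them the mass
`2 ^ (-n) exp (-n H₀(t))`; this bounds exponential sums from above (`expMass_le`). Changing to the
product measure of mean `m`, which concentrates at `m`, bounds them from below
(`eventually_le_expMass`). Hence `|x̄|` concentrates at `m` under `betaOf m`
(`tendsto_prob_abs_avg`), and null probabilities of sets of magnetizations are known on the
exponential scale (`eventually_prob_le`, `eventually_le_prob`).

*The estimators order configurations by `|x̄|`*, up to vanishing errors (`RanksByAbsAvg`). The
p-value at a typical configuration of the alternative is then, on the exponential scale, the null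
probability of `|x̄| > m`, which gives the slope (`RanksByAbsAvg.isBahadurSlope`). For the closed
form `η₂(x̄)` the ordering is the monotonicity of `η₂`. The other two estimators maximize a function
`1 / D` with `D` convex, so they are located by comparing two values of `D`. For the likelihood, `D`
is a normalized partition function, compared by means of the Laplace bounds
(`eventually_invLikelihood_lt`). For the pseudolikelihood, the derivative of `log D` at `betaOf m`
is explicit, and its sign is that of `m - |x̄|` once `|x̄|` stays away from `m`
(`eventually_scoreNum_pos`, `eventually_scoreNum_neg`).
-/

noncomputable section

namespace CurieWeiss

open Filter Topology

/-! ### The rate function and its maximizers -/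

lemma artanh_eq {t : ℝ} (h1 : -1 < t) (h2 : t < 1) :
    Real.artanh t = (Real.log (1 + t) - Real.log (1 - t)) / 2 := by
  rw [Real.artanh_eq_half_log ⟨h1.le, h2.le⟩, Real.log_div (by linarith) (by linarith)]
  ring

lemma hasDerivAt_artanh {t : ℝ} (h1 : -1 < t) (h2 : t < 1) :
    HasDerivAt Real.artanh (1 / (1 - t ^ 2)) t := by
  have key : HasDerivAt (fun s : ℝ => (Real.log (1 + s) - Real.log (1 - s)) / 2)
      ((1 / (1 + t) - (-1) / (1 - t)) / 2) t := by
    refine HasDerivAt.div_const (HasDerivAt.sub ?_ ?_) 2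
    · exact ((hasDerivAt_id t).const_add 1).log (by simp; linarith)
    · exact ((hasDerivAt_id t).const_sub 1).log (by simp; linarith)
  have e : (1 / (1 + t) - (-1) / (1 - t)) / 2 = 1 / (1 - t ^ 2) := by
    have a : 1 + t ≠ 0 := by linarith
    have b : 1 - t ≠ 0 := by linarith
    have c : 1 - t ^ 2 ≠ 0 := by
      have : 1 - t ^ 2 = (1 + t) * (1 - t) := by ring
      rw [this]; exact mul_ne_zero a b
    field_simp
    ring
  rw [e] at key
  refine key.congr_of_eventuallyEq ?_
  filter_upwards [Ioo_mem_nhds h1 h2] with s hs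
  exact artanh_eq hs.1 hs.2

lemma lt_artanh {t : ℝ} (h0 : 0 < t) (h1 : t < 1) : t < Real.artanh t := by
  have mono : StrictMonoOn (fun s : ℝ => Real.artanh s - s) (Set.Ico 0 1) := by
    refine strictMonoOn_of_deriv_pos (convex_Ico 0 1) ?_ ?_
    · intro s hs
      exact ((hasDerivAt_artanh (by linarith [hs.1]) hs.2).sub
        (hasDerivAt_id s)).continuousAt.continuousWithinAt
    · intro s hs
      rw [interior_Ico] at hs
      have hd : HasDerivAt (fun s : ℝ => Real.artanh s - s) (1 / (1 - s ^ 2) - 1) s :=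
        (hasDerivAt_artanh (by linarith [hs.1]) hs.2).sub (hasDerivAt_id s)
      rw [hd.deriv, sub_pos, lt_div_iff₀ (by nlinarith [hs.1, hs.2])]
      nlinarith [hs.1, hs.2, pow_pos hs.1 2]
  have := mono ⟨le_rfl, one_pos⟩ ⟨h0.le, h1⟩ h0
  simp only [Real.artanh_zero] at this
  linarith

lemma artanh_lt {t : ℝ} (h0 : 0 < t) (h1 : t < 1) : Real.artanh t < t / (1 - t ^ 2) := by
  have hd : ∀ s ∈ Set.Ico (0 : ℝ) 1, HasDerivAt (fun s : ℝ => s / (1 - s ^ 2) - Real.artanh s)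
      (2 * s ^ 2 / (1 - s ^ 2) ^ 2) s := by
    intro s hs
    have hne : 1 - s ^ 2 ≠ 0 := by nlinarith [hs.1, hs.2]
    have hden : HasDerivAt (fun s : ℝ => 1 - s ^ 2) (-(2 * s)) s := by
      simpa using (hasDerivAt_pow 2 s).const_sub 1
    refine (((hasDerivAt_id s).div hden hne).sub
      (hasDerivAt_artanh (by linarith [hs.1]) hs.2)).congr_deriv ?_
    simp only [id]
    field_simp
    ring
  have mono : StrictMonoOn (fun s : ℝ => s / (1 - s ^ 2) - Real.artanh s) (Set.Ico 0 1) := by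
    refine strictMonoOn_of_deriv_pos (convex_Ico 0 1)
      (fun s hs => (hd s hs).continuousAt.continuousWithinAt) ?_
    intro s hs
    rw [interior_Ico] at hs
    rw [(hd s ⟨hs.1.le, hs.2⟩).deriv]
    have : 0 < 1 - s ^ 2 := by nlinarith [hs.1, hs.2]
    have := hs.1
    positivity
  have := mono ⟨le_rfl, one_pos⟩ ⟨h0.le, h1⟩ h0
  simp only [Real.artanh_zero] at this
  simp at this
  linarith

/-- The inverse temperature `artanh m / (2m)` at which `m ∈ (0,1)` is the critical point of `H`;
for such `m` it is the real number `η₂(m)`. -/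
def betaOf (m : ℝ) : ℝ := Real.artanh m / (2 * m)

lemma artanh_eq_betaOf_mul {m : ℝ} (h0 : 0 < m) : Real.artanh m = 2 * betaOf m * m := by
  unfold betaOf; field_simp

lemma hasDerivAt_betaOf {t : ℝ} (h0 : 0 < t) (h1 : t < 1) :
    HasDerivAt betaOf ((t / (1 - t ^ 2) - Real.artanh t) / (2 * t ^ 2)) t := by
  have h2 : HasDerivAt (fun s : ℝ => 2 * s) 2 t := by
    simpa using (hasDerivAt_id t).const_mul 2
  refine ((hasDerivAt_artanh (by linarith) h1).div h2 (by positivity)).congr_deriv ?_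
  have : 1 - t ^ 2 ≠ 0 := by nlinarith
  field_simp

lemma strictMonoOn_betaOf : StrictMonoOn betaOf (Set.Ioo 0 1) := by
  refine strictMonoOn_of_deriv_pos (convex_Ioo 0 1)
    (fun s hs => (hasDerivAt_betaOf hs.1 hs.2).continuousAt.continuousWithinAt) ?_
  intro s hs
  rw [interior_Ioo] at hs
  rw [(hasDerivAt_betaOf hs.1 hs.2).deriv]
  have := artanh_lt hs.1 hs.2
  have := hs.1
  exact div_pos (by linarith) (by positivity)

lemma half_lt_betaOf {m : ℝ} (h0 : 0 < m) (h1 : m < 1) : 1 / 2 < betaOf m := by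
  have := lt_artanh h0 h1
  unfold betaOf
  rw [lt_div_iff₀ (by positivity)]
  linarith

/-- Every inverse temperature above the threshold `1/2` has a critical magnetization. -/
lemma exists_betaOf_eq {b : ℝ} (hb : 1 / 2 < b) : ∃ m, 0 < m ∧ m < 1 ∧ betaOf m = b := by
  have hb2 : 0 < 2 * b := by linarith
  -- near `1` the value exceeds `b`, since `artanh (tanh (2b)) = 2b`
  have hv1 : Real.tanh (2 * b) < 1 := Real.tanh_lt_one _
  have hv0 : 0 < Real.tanh (2 * b) := by
    rw [Real.tanh_eq_sinh_div_cosh]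
    exact div_pos (Real.sinh_pos_iff.2 hb2) (Real.cosh_pos _)
  have hv : b ≤ betaOf (Real.tanh (2 * b)) := by
    unfold betaOf
    rw [Real.artanh_tanh, le_div_iff₀ (by positivity)]
    nlinarith
  -- near `0` it is below `b`, since `artanh t < t / (1 - t ^ 2)`
  obtain ⟨u, hu0, hu1, hub⟩ : ∃ u : ℝ, 0 < u ∧ u < 1 ∧ u ^ 2 ≤ 1 - 1 / (2 * b) := by
    have hpos : 0 < 1 - 1 / (2 * b) := by
      rw [sub_pos, div_lt_one hb2]; linarith
    have hlt : 1 - 1 / (2 * b) < 1 := by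
      have : 0 < 1 / (2 * b) := by positivity
      linarith
    refine ⟨Real.sqrt (1 - 1 / (2 * b)), Real.sqrt_pos.2 hpos, ?_, (Real.sq_sqrt hpos.le).le⟩
    rw [Real.sqrt_lt' one_pos]; simpa using hlt
  have hu : betaOf u ≤ b := by
    have h := artanh_lt hu0 hu1
    have hw : 0 < 1 - u ^ 2 := by nlinarith
    have : 1 / (1 - u ^ 2) ≤ 2 * b := by
      rw [div_le_iff₀ hw]
      have : 1 / (2 * b) ≤ 1 - u ^ 2 := by linarith
      rw [div_le_iff₀ hb2] at this
      linarith
    unfold betaOf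
    rw [div_le_iff₀ (by positivity)]
    have e : u / (1 - u ^ 2) = u * (1 / (1 - u ^ 2)) := by ring
    rw [e] at h
    nlinarith
  have hsub : Set.uIcc u (Real.tanh (2 * b)) ⊆ Set.Ioo 0 1 := by
    intro s hs
    rw [Set.mem_uIcc] at hs
    constructor <;> rcases hs with hs | hs <;> linarith [hs.1, hs.2]
  have hc : ContinuousOn betaOf (Set.uIcc u (Real.tanh (2 * b))) := fun s hs =>
    (hasDerivAt_betaOf (hsub hs).1 (hsub hs).2).continuousAt.continuousWithinAt
  obtain ⟨m, hm, hmb⟩ := intermediate_value_uIcc hc (Set.mem_uIcc.2 (Or.inl ⟨hu, hv⟩))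
  exact ⟨m, (hsub hm).1, (hsub hm).2, hmb⟩

lemma continuous_H (b : ℝ) : Continuous (H b 2) := by
  have h1 : Continuous fun x : ℝ => (1 + x) * Real.log (1 + x) :=
    Real.continuous_mul_log.comp (continuous_const.add continuous_id)
  have h2 : Continuous fun x : ℝ => (1 - x) * Real.log (1 - x) :=
    Real.continuous_mul_log.comp (continuous_const.sub continuous_id)
  unfold H
  exact (continuous_const.mul (continuous_pow 2)).sub ((h1.add h2).div_const 2)

lemma H_neg (b x : ℝ) : H b 2 (-x) = H b 2 x := by
  unfold H
  simp only [sub_neg_eq_add, ← sub_eq_add_neg]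
  ring

lemma H_abs (b x : ℝ) : H b 2 |x| = H b 2 x := by
  rcases abs_choice x with h | h <;> rw [h]
  exact H_neg b x

lemma H_zero (b : ℝ) : H b 2 0 = 0 := by simp [H]

lemma H_sub (b c x : ℝ) : H b 2 x - H c 2 x = (b - c) * x ^ 2 := by
  unfold H; ring

lemma hasDerivAt_H (b : ℝ) {t : ℝ} (h1 : -1 < t) (h2 : t < 1) :
    HasDerivAt (H b 2) (2 * b * t - Real.artanh t) t := by
  have hp : HasDerivAt (fun x : ℝ => b * x ^ 2) (b * (2 * t)) t := by
    simpa using (hasDerivAt_pow 2 t).const_mul b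
  have ha : HasDerivAt (fun x : ℝ => (1 + x) * Real.log (1 + x)) (Real.log (1 + t) + 1) t := by
    have h := (Real.hasDerivAt_mul_log (x := 1 + t) (by linarith)).comp t
      ((hasDerivAt_id' t).const_add 1)
    exact h.congr_deriv (by ring)
  have hs : HasDerivAt (fun x : ℝ => (1 - x) * Real.log (1 - x))
      (-(Real.log (1 - t) + 1)) t := by
    have h := (Real.hasDerivAt_mul_log (x := 1 - t) (by linarith)).comp t
      ((hasDerivAt_id' t).const_sub 1)
    exact h.congr_deriv (by ring)
  refine (hp.sub ((ha.add hs).div_const 2)).congr_deriv ?_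
  rw [artanh_eq h1 h2]
  ring

lemma strictMonoOn_H {m : ℝ} (h0 : 0 < m) (h1 : m < 1) :
    StrictMonoOn (H (betaOf m) 2) (Set.Icc 0 m) := by
  refine strictMonoOn_of_deriv_pos (convex_Icc 0 m) (continuous_H _).continuousOn ?_
  intro s hs
  rw [interior_Icc] at hs
  have hs1 : s < 1 := hs.2.trans h1
  rw [(hasDerivAt_H _ (by linarith [hs.1]) hs1).deriv, artanh_eq_betaOf_mul hs.1]
  have := strictMonoOn_betaOf ⟨hs.1, hs1⟩ ⟨h0, h1⟩ hs.2
  nlinarith [hs.1]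

lemma strictAntiOn_H {m : ℝ} (h0 : 0 < m) (h1 : m < 1) :
    StrictAntiOn (H (betaOf m) 2) (Set.Icc m 1) := by
  refine strictAntiOn_of_deriv_neg (convex_Icc m 1) (continuous_H _).continuousOn ?_
  intro s hs
  rw [interior_Icc] at hs
  have hs0 : 0 < s := h0.trans hs.1
  rw [(hasDerivAt_H _ (by linarith) hs.2).deriv, artanh_eq_betaOf_mul hs0]
  have := strictMonoOn_betaOf ⟨h0, h1⟩ ⟨hs0, hs.2⟩ hs.1
  nlinarith

lemma H_lt_of_abs_ne {m y : ℝ} (h0 : 0 < m) (h1 : m < 1) (hy : |y| ≤ 1) (hne : |y| ≠ m) :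
    H (betaOf m) 2 y < H (betaOf m) 2 m := by
  rw [← H_abs _ y]
  rcases lt_or_gt_of_ne hne with h | h
  · exact strictMonoOn_H h0 h1 ⟨abs_nonneg y, h.le⟩ ⟨h0.le, le_rfl⟩ h
  · exact strictAntiOn_H h0 h1 ⟨le_rfl, h1.le⟩ ⟨h.le, hy⟩ h

lemma H_le_max {m y : ℝ} (h0 : 0 < m) (h1 : m < 1) (hy : |y| ≤ 1) :
    H (betaOf m) 2 y ≤ H (betaOf m) 2 m := by
  rcases eq_or_ne |y| m with h | h
  · rw [← h, H_abs]
  · exact (H_lt_of_abs_ne h0 h1 hy h).le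

lemma supH_betaOf {m : ℝ} (h0 : 0 < m) (h1 : m < 1) :
    supH (betaOf m) 2 = H (betaOf m) 2 m := by
  refine IsGreatest.csSup_eq ⟨⟨m, ⟨by linarith, h1.le⟩, rfl⟩, ?_⟩
  rintro _ ⟨y, hy, rfl⟩
  exact H_le_max h0 h1 (abs_le.2 hy)

lemma mStar_betaOf {m : ℝ} (h0 : 0 < m) (h1 : m < 1) : mStar (betaOf m) 2 = m := by
  have hspec : 0 < mStar (betaOf m) 2 ∧ mStar (betaOf m) 2 ≤ 1 ∧
      ∀ y ∈ Set.Icc (-1 : ℝ) 1, H (betaOf m) 2 y ≤ H (betaOf m) 2 (mStar (betaOf m) 2) :=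
    Classical.epsilon_spec (p := fun k : ℝ => 0 < k ∧ k ≤ 1 ∧
      ∀ y ∈ Set.Icc (-1 : ℝ) 1, H (betaOf m) 2 y ≤ H (betaOf m) 2 k)
      ⟨m, h0, h1.le, fun y hy => H_le_max h0 h1 (abs_le.2 hy)⟩
  obtain ⟨hp, hle, hmax⟩ := hspec
  by_contra hne
  have habs := abs_of_pos hp
  have := H_lt_of_abs_ne h0 h1 (habs.le.trans hle) (by rwa [habs])
  exact absurd (hmax m ⟨by linarith, h1.le⟩) (not_le.2 this)

lemma half_le_betaStar : 1 / 2 ≤ betaStar 2 := by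
  have hbdd : BddAbove {β : ℝ | 0 ≤ β ∧ supH β 2 = 0} := by
    refine ⟨Real.log 2, ?_⟩
    rintro β ⟨-, hβ⟩
    have hb : BddAbove (H β 2 '' Set.Icc (-1) 1) :=
      (isCompact_Icc.image (continuous_H β)).bddAbove
    have h1 : H β 2 1 ≤ supH β 2 := le_csSup hb ⟨1, by simp, rfl⟩
    have e : H β 2 1 = β - Real.log 2 := by
      unfold H; norm_num
    linarith
  refine le_csSup hbdd ⟨by norm_num, ?_⟩
  have hanti : AntitoneOn (H (1 / 2) 2) (Set.Icc 0 1) := by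
    refine antitoneOn_of_deriv_nonpos (convex_Icc 0 1) (continuous_H _).continuousOn ?_ ?_
    · intro s hs
      rw [interior_Icc] at hs
      exact (hasDerivAt_H _ (by linarith [hs.1])
        hs.2).differentiableAt.differentiableWithinAt
    · intro s hs
      rw [interior_Icc] at hs
      rw [(hasDerivAt_H _ (by linarith [hs.1]) hs.2).deriv]
      linarith [lt_artanh hs.1 hs.2]
  refine IsGreatest.csSup_eq ⟨⟨0, by simp, H_zero _⟩, ?_⟩
  rintro _ ⟨y, hy, rfl⟩
  rw [← H_abs, ← H_zero (1 / 2)]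
  exact hanti ⟨le_rfl, zero_le_one⟩ ⟨abs_nonneg y, abs_le.2 hy⟩ (abs_nonneg y)

/-! ### The closed-form pseudolikelihood estimator as a function of the magnetization -/

lemma eta_zero : eta 2 0 = 0 := by simp [eta]

lemma eta_one : eta 2 1 = ⊤ := by
  simp only [eta, artanhExt]
  norm_num
  exact EReal.coe_mul_top_of_pos (by norm_num)

lemma eta_neg_one : eta 2 (-1) = ⊤ := by
  simp only [eta, artanhExt]
  norm_num
  exact EReal.coe_mul_bot_of_pos (by norm_num)

lemma eta_of_pos {t : ℝ} (h0 : 0 < t) (h1 : t < 1) : eta 2 t = (betaOf t : EReal) := by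
  have hn : t ≠ -1 := by linarith
  simp only [eta, artanhExt, h0.ne', h1.ne, hn, if_false]
  rw [← EReal.coe_mul]
  congr 1
  unfold betaOf
  norm_num [zpow_neg]
  field_simp

lemma artanh_neg_eq {t : ℝ} (h1 : -1 < t) (h2 : t < 1) :
    Real.artanh (-t) = -Real.artanh t := by
  rw [artanh_eq h1 h2, artanh_eq (by linarith) (by linarith)]
  simp only [sub_neg_eq_add, ← sub_eq_add_neg]
  ring

lemma eta_abs {t : ℝ} (ht : |t| ≤ 1) : eta 2 |t| = eta 2 t := by
  rcases abs_choice t with h | h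
  · rw [h]
  · rcases (abs_nonneg t).eq_or_lt' with h0 | h0
    · rw [h0, abs_eq_zero.1 h0]
    · rcases ht.eq_or_lt with h1 | h1
      · have : t = -1 := by linarith
        rw [h1, this, eta_one, eta_neg_one]
      · rw [eta_of_pos h0 h1, h] at *
        have hn : t ≠ -1 := by linarith
        have hn1 : t ≠ 1 := by linarith
        have hn0 : t ≠ 0 := by linarith
        simp only [eta, artanhExt, hn, hn1, hn0, if_false]
        rw [← EReal.coe_mul]
        congr 1
        unfold betaOf
        rw [artanh_neg_eq (by linarith) (by linarith)]
        norm_num [zpow_neg]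
        field_simp

/-- `η₂` is strictly increasing in `|t|`, including the conventional value `0` at `t = 0`. -/
lemma eta_lt_eta {s t : ℝ} (ht : |t| ≤ 1) (hst : |s| < |t|) : eta 2 s < eta 2 t := by
  rw [← eta_abs ht, ← eta_abs (hst.le.trans ht)]
  have hs := abs_nonneg s
  set u := |s|
  set v := |t|
  have hv : 0 < v := hs.trans_lt hst
  have hu1 : u < 1 := hst.trans_le ht
  rcases hs.eq_or_lt' with h0 | h0
  · rw [h0, eta_zero]
    rcases ht.eq_or_lt with h1 | h1
    · rw [h1, eta_one]; exact EReal.zero_lt_top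
    · rw [eta_of_pos hv h1]
      exact_mod_cast (half_lt_betaOf hv h1).trans' (by norm_num)
  · rw [eta_of_pos h0 hu1]
    rcases ht.eq_or_lt with h1 | h1
    · rw [h1, eta_one]; exact EReal.coe_lt_top _
    · rw [eta_of_pos hv h1]
      exact_mod_cast strictMonoOn_betaOf ⟨h0, hu1⟩ ⟨hv, h1⟩ hst

lemma betaOf_lt_eta_iff {m x : ℝ} (h0 : 0 < m) (h1 : m < 1) (hx : |x| ≤ 1) :
    (betaOf m : EReal) < eta 2 x ↔ m < |x| := by
  have hm := abs_of_pos h0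
  rw [← eta_of_pos h0 h1]
  constructor
  · intro h
    by_contra! hle
    rcases hle.eq_or_lt with he | hlt
    · rw [← he, eta_abs hx] at h
      exact lt_irrefl _ h
    · exact lt_asymm h (eta_lt_eta (hm.le.trans h1.le) (by rwa [hm]))
  · intro h
    exact eta_lt_eta hx (by rwa [hm])

/-! ### The two slopes -/

lemma sSup_H_Ioc {m₀ m : ℝ} (h0 : 0 < m₀) (h1 : m < 1) (hm : m₀ < m) :
    sSup (H (betaOf m₀) 2 '' Set.Ioc m 1) = H (betaOf m₀) 2 m := by
  have hanti := strictAntiOn_H h0 (hm.trans h1)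
  refine IsLUB.csSup_eq ⟨?_, ?_⟩ ⟨_, 1, ⟨h1, le_rfl⟩, rfl⟩
  · rintro _ ⟨y, hy, rfl⟩
    exact (hanti ⟨hm.le, h1.le⟩ ⟨(hm.trans hy.1).le, hy.2⟩ hy.1).le
  · intro u hu
    have hlim : Tendsto (H (betaOf m₀) 2) (𝓝[>] m) (𝓝 (H (betaOf m₀) 2 m)) :=
      (continuous_H _).continuousWithinAt.tendsto
    refine le_of_tendsto hlim ?_
    filter_upwards [Ioc_mem_nhdsGT h1] with y hy
    exact hu ⟨y, hy, rfl⟩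

lemma slopeML_betaOf {m₀ m : ℝ} (h0 : 0 < m₀) (h1 : m < 1) (hm : m₀ < m) :
    slopeML (betaOf m₀) (betaOf m) 2 = 2 * (H (betaOf m₀) 2 m₀ - H (betaOf m₀) 2 m) := by
  unfold slopeML
  rw [supH_betaOf h0 (hm.trans h1), mStar_betaOf (h0.trans hm) h1, sSup_H_Ioc h0 h1 hm]

lemma slopeMPL_eq_slopeML {m₀ m : ℝ} (h0 : 0 < m) (h1 : m < 1) :
    slopeMPL (betaOf m₀) (betaOf m) 2 = slopeML (betaOf m₀) (betaOf m) 2 := by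
  unfold slopeMPL slopeML
  rw [mStar_betaOf h0 h1]
  congr 3
  ext z
  constructor
  · rintro ⟨x, ⟨hx, hb⟩, rfl⟩
    have hx' := abs_le.2 hx
    exact ⟨|x|, ⟨(betaOf_lt_eta_iff h0 h1 hx').1 hb, hx'⟩, H_abs _ x⟩
  · rintro ⟨x, hx, rfl⟩
    have hx0 : |x| = x := abs_of_pos (h0.trans hx.1)
    exact ⟨x, ⟨⟨by linarith [hx.1], hx.2⟩,
      (betaOf_lt_eta_iff h0 h1 (hx0.le.trans hx.2)).2 (by rw [hx0]; exact hx.1)⟩, rfl⟩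

/-! ### Configurations and product weights -/

lemma spin_eq_or {n : ℕ} (x : Config n) (i : Fin n) : spin x i = 1 ∨ spin x i = -1 := by
  unfold spin
  rcases Int.units_eq_one_or (x i) with h | h <;> simp [h]

lemma mul_avg {n : ℕ} (x : Config n) : (n : ℝ) * avg x = ∑ i, spin x i := by
  rcases Nat.eq_zero_or_pos n with rfl | hn
  · simp
  · unfold avg
    have : (n : ℝ) ≠ 0 := by positivity
    field_simp

lemma abs_avg_le_one {n : ℕ} (x : Config n) : |avg x| ≤ 1 := by
  rcases Nat.eq_zero_or_pos n with rfl | hn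
  · simp [avg]
  · have hn' : (0 : ℝ) < n := by exact_mod_cast hn
    have h : |∑ i, spin x i| ≤ n := by
      refine (Finset.abs_sum_le_sum_abs _ _).trans ?_
      refine (Finset.sum_le_card_nsmul _ _ 1 fun i _ => ?_).trans (by simp)
      rcases spin_eq_or x i with h | h <;> simp [h]
    rw [← mul_avg, abs_mul, abs_of_pos hn'] at h
    exact le_of_mul_le_mul_left (by simpa using h) hn'

lemma hamiltonian_two {n : ℕ} (x : Config n) : hamiltonian 2 n x = n * avg x ^ 2 := by
  unfold hamiltonian
  rw [← Fintype.sum_pow, ← mul_avg]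
  rcases Nat.eq_zero_or_pos n with rfl | hn
  · norm_num
  · have : (n : ℝ) ≠ 0 := by positivity
    norm_num [zpow_neg]
    field_simp

lemma card_avg_image_le (n : ℕ) :
    (Finset.univ.image (avg : Config n → ℝ)).card ≤ n + 1 := by
  classical
  have hsub : Finset.univ.image (avg : Config n → ℝ) ⊆
      (Finset.range (n + 1)).image (fun k : ℕ => (n : ℝ)⁻¹ * (2 * k - n)) := by
    intro t ht
    obtain ⟨x, -, rfl⟩ := Finset.mem_image.1 ht
    refine Finset.mem_image.2 ⟨(Finset.univ.filter fun i => x i = 1).card, ?_, ?_⟩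
    · rw [Finset.mem_range, Nat.lt_succ_iff]
      exact (Finset.card_le_univ _).trans (by simp)
    · unfold avg
      congr 1
      have : ∀ i, spin x i = 2 * (if x i = 1 then 1 else 0) - 1 := by
        intro i
        unfold spin
        rcases Int.units_eq_one_or (x i) with h | h
        · rw [h]; norm_num
        · rw [h]; norm_num [show (-1 : ℤˣ) ≠ 1 by decide]
      simp_rw [this, Finset.sum_sub_distrib, ← Finset.mul_sum, Finset.sum_boole]
      simp
  exact (Finset.card_le_card hsub).trans (Finset.card_image_le.trans (by simp))

/-- The product weights with mean magnetization `m` have total mass `2 ^ n`. -/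
lemma sum_prod_one_add (m : ℝ) (n : ℕ) :
    ∑ x : Config n, ∏ i, (1 + m * spin x i) = 2 ^ n := by
  have h := Finset.prod_univ_sum (fun _ : Fin n => (Finset.univ : Finset ℤˣ))
    (fun _ u => 1 + m * ((u : ℤ) : ℝ))
  rw [Fintype.piFinset_univ] at h
  unfold spin
  rw [← h, Finset.prod_const, Finset.card_univ, Fintype.card_fin, UnitsInt.univ,
    Finset.sum_insert (by decide), Finset.sum_singleton]
  congr 1
  push_cast
  ring

/-- Per-site logarithm of the product weight with mean `m`, at magnetization `t`. -/
def logWeight (m t : ℝ) : ℝ := ((1 + t) * Real.log (1 + m) + (1 - t) * Real.log (1 - m)) / 2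

lemma prod_one_add_eq_exp {n : ℕ} {m : ℝ} (x : Config n) (h : ∀ i, 0 < 1 + m * spin x i) :
    ∏ i, (1 + m * spin x i) = Real.exp (n * logWeight m (avg x)) := by
  have h1 : ∀ i, 1 + m * spin x i = Real.exp (((1 + spin x i) * Real.log (1 + m) +
      (1 - spin x i) * Real.log (1 - m)) / 2) := by
    intro i
    rw [← Real.exp_log (h i)]
    congr 1
    rcases spin_eq_or x i with h | h <;> rw [h] <;> ring_nf
  rw [Finset.prod_congr rfl fun i _ => h1 i, ← Real.exp_sum]
  congr 1
  rw [← Finset.sum_div, Finset.sum_add_distrib, ← Finset.sum_mul, ← Finset.sum_mul,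
    Finset.sum_add_distrib, Finset.sum_sub_distrib, ← mul_avg]
  unfold logWeight
  simp
  ring

lemma logWeight_self (t : ℝ) : logWeight t t = -H 0 2 t := by
  unfold logWeight H; ring

/-- All factors of the product weight are positive at a configuration whose magnetization is the
mean, even when that magnetization is `±1`. -/
lemma one_add_avg_mul_spin_pos {n : ℕ} (x : Config n) (i : Fin n) :
    0 < 1 + avg x * spin x i := by
  have hn : (0 : ℝ) < n := by exact_mod_cast Fin.pos i
  have key : (n : ℝ) * (1 + avg x * spin x i) = ∑ j, (1 + spin x j * spin x i) := by
    rw [Finset.sum_add_distrib, ← Finset.sum_mul, ← mul_avg]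
    simp
    ring
  have hle : 1 + spin x i * spin x i ≤ ∑ j, (1 + spin x j * spin x i) := by
    refine Finset.single_le_sum (f := fun j => 1 + spin x j * spin x i) (fun j _ => ?_)
      (Finset.mem_univ i)
    rcases spin_eq_or x i with h | h <;> rcases spin_eq_or x j with h' | h' <;> simp [h, h']
  have : 0 < (n : ℝ) * (1 + avg x * spin x i) := by
    rw [key]; nlinarith [mul_self_nonneg (spin x i)]
  exact pos_of_mul_pos_right this hn.le

/-! ### Exponential sums over configurations -/

/-- The sum of `exp (n g(x̄))` over the configurations in `A`, under the uniform distribution. -/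
def expMass (g : ℝ → ℝ) (n : ℕ) (A : Set (Config n)) : ℝ :=
  ((2 : ℝ) ^ n)⁻¹ * ∑ x, A.indicator (fun x => Real.exp (n * g (avg x))) x

lemma expMass_mono (g : ℝ → ℝ) {n : ℕ} {A B : Set (Config n)} (h : A ⊆ B) :
    expMass g n A ≤ expMass g n B := by
  unfold expMass
  gcongr with x

lemma expMass_compl (g : ℝ → ℝ) {n : ℕ} (A : Set (Config n)) :
    expMass g n A + expMass g n Aᶜ = expMass g n Set.univ := by
  unfold expMass
  rw [← mul_add, ← Finset.sum_add_distrib]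
  simp only [Set.indicator_univ, Set.indicator_self_add_compl_apply]

lemma expMass_univ_pos (g : ℝ → ℝ) (n : ℕ) : 0 < expMass g n Set.univ := by
  unfold expMass
  simp only [Set.indicator_univ]
  have : 0 < ∑ x : Config n, Real.exp (n * g (avg x)) :=
    Finset.sum_pos (fun _ _ => Real.exp_pos _) Finset.univ_nonempty
  positivity

/-- Upper Laplace bound: since each value `t` of the magnetization is taken by at most
`2 ^ n exp (n H₀(t))` configurations, only the supremum of `g + H₀` matters, up to a factor
counting the `n + 1` values. -/
lemma expMass_le (g : ℝ → ℝ) {n : ℕ} (A : Set (Config n)) (M : ℝ)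
    (h : ∀ x ∈ A, g (avg x) + H 0 2 (avg x) ≤ M) :
    expMass g n A ≤ (n + 1) * Real.exp (n * M) := by
  classical
  have h1 : ∀ x : Config n, A.indicator (fun x => Real.exp (n * g (avg x))) x ≤
      Real.exp (n * M) * ∏ i, (1 + avg x * spin x i) := by
    intro x
    rw [prod_one_add_eq_exp x (one_add_avg_mul_spin_pos x), ← Real.exp_add, logWeight_self]
    by_cases hx : x ∈ A
    · rw [Set.indicator_of_mem hx, Real.exp_le_exp]
      have : (n : ℝ) * (g (avg x) + H 0 2 (avg x)) ≤ n * M := by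
        gcongr; exact h x hx
      linarith
    · rw [Set.indicator_of_notMem hx]; positivity
  have h2 : ∑ x : Config n, ∏ i, (1 + avg x * spin x i) ≤ (n + 1) * 2 ^ n := by
    rw [← Finset.sum_fiberwise_of_maps_to
      (t := Finset.univ.image (avg : Config n → ℝ)) (g := avg)
      (fun x hx => Finset.mem_image_of_mem _ hx)]
    have h3 : ∀ t ∈ Finset.univ.image (avg : Config n → ℝ),
        ∑ x ∈ Finset.univ.filter (fun x : Config n => avg x = t),
          ∏ i, (1 + avg x * spin x i) ≤ 2 ^ n := by
      intro t ht
      obtain ⟨y, -, rfl⟩ := Finset.mem_image.1 ht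
      have hy := abs_le.1 (abs_avg_le_one y)
      rw [← sum_prod_one_add (avg y) n]
      refine (Finset.sum_congr rfl fun x hx => ?_).trans_le
        (Finset.sum_le_sum_of_subset_of_nonneg (Finset.subset_univ _) fun x _ _ => ?_)
      · rw [(Finset.mem_filter.1 hx).2]
      · refine Finset.prod_nonneg fun i _ => ?_
        rcases spin_eq_or x i with h | h <;> rw [h] <;> linarith [hy.1, hy.2]
    refine (Finset.sum_le_card_nsmul _ _ _ h3).trans ?_
    rw [nsmul_eq_mul]
    gcongr
    exact_mod_cast card_avg_image_le n
  unfold expMass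
  rw [inv_mul_le_iff₀ (by positivity)]
  calc _ ≤ ∑ x : Config n, Real.exp (n * M) * ∏ i, (1 + avg x * spin x i) :=
        Finset.sum_le_sum fun x _ => h1 x
    _ = Real.exp (n * M) * ∑ x : Config n, ∏ i, (1 + avg x * spin x i) := by
        rw [Finset.mul_sum]
    _ ≤ Real.exp (n * M) * ((n + 1) * 2 ^ n) := by gcongr
    _ = _ := by ring

lemma eventually_succ_mul_exp_lt {c η : ℝ} (hc : 0 < c) (hη : 0 < η) :
    ∀ᶠ n : ℕ in atTop, ((n : ℝ) + 1) * Real.exp (-(n * c)) < η := by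
  have hr : Real.exp (-c) < 1 := Real.exp_lt_one_iff.2 (by linarith)
  have h := (tendsto_self_mul_const_pow_of_lt_one (Real.exp_pos _).le hr).add
    (tendsto_pow_atTop_nhds_zero_of_lt_one (Real.exp_pos _).le hr)
  rw [add_zero] at h
  filter_upwards [h.eventually (gt_mem_nhds hη)] with n hn
  rw [← Real.exp_nat_mul] at hn
  calc _ = (n : ℝ) * Real.exp (n * -c) + Real.exp (n * -c) := by ring_nf
    _ < η := hn

lemma eventually_succ_le_exp {c : ℝ} (hc : 0 < c) :
    ∀ᶠ n : ℕ in atTop, ((n : ℝ) + 1) ≤ Real.exp (n * c) := by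
  filter_upwards [eventually_succ_mul_exp_lt hc one_pos] with n hn
  rw [Real.exp_neg, mul_inv_lt_iff₀ (Real.exp_pos _)] at hn
  linarith

lemma logWeight_eq {m t : ℝ} (h1 : -1 < m) (h2 : m < 1) :
    logWeight m t = (Real.log (1 + m) + Real.log (1 - m)) / 2 + t * Real.artanh m := by
  rw [artanh_eq h1 h2]; unfold logWeight; ring

lemma continuous_logWeight (m : ℝ) : Continuous (logWeight m) := by
  unfold logWeight; fun_prop

/-- Relative entropy with respect to the product weight of mean `m` is bounded below away
from `m`. -/
lemma exists_logWeight_add_H_le {m δ : ℝ} (h1 : -1 < m) (h2 : m < 1) (hδ : 0 < δ) :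
    ∃ c, 0 < c ∧ ∀ t, |t| ≤ 1 → δ ≤ |t - m| → logWeight m t + H 0 2 t ≤ -c := by
  set f : ℝ → ℝ := fun t => logWeight m t + H 0 2 t with hf
  have hcont : Continuous f := (continuous_logWeight m).add (continuous_H 0)
  have hd : ∀ t, -1 < t → t < 1 → HasDerivAt f (Real.artanh m - Real.artanh t) t := by
    intro t ht1 ht2
    have : f = fun t => ((Real.log (1 + m) + Real.log (1 - m)) / 2 + t * Real.artanh m) +
        H 0 2 t := by
      ext s; simp only [hf, logWeight_eq h1 h2]
    rw [this]
    refine ((((hasDerivAt_id' t).mul_const _).const_add _).add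
      (hasDerivAt_H 0 ht1 ht2)).congr_deriv ?_
    ring
  have hm0 : f m = 0 := by simp only [hf, logWeight_self]; ring
  have hmono : StrictMonoOn f (Set.Icc (-1) m) := by
    refine strictMonoOn_of_deriv_pos (convex_Icc _ _) hcont.continuousOn fun s hs => ?_
    rw [interior_Icc] at hs
    rw [(hd s hs.1 (hs.2.trans h2)).deriv, sub_pos]
    exact Real.artanh_lt_artanh hs.1 h2 hs.2
  have hanti : StrictAntiOn f (Set.Icc m 1) := by
    refine strictAntiOn_of_deriv_neg (convex_Icc _ _) hcont.continuousOn fun s hs => ?_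
    rw [interior_Icc] at hs
    rw [(hd s (h1.trans hs.1) hs.2).deriv, sub_neg]
    exact Real.artanh_lt_artanh h1 hs.2 hs.1
  have hneg : ∀ t, |t| ≤ 1 → t ≠ m → f t < 0 := by
    intro t ht hne
    rw [abs_le] at ht
    rw [← hm0]
    rcases lt_or_gt_of_ne hne with h | h
    · exact hmono ⟨ht.1, h.le⟩ ⟨h1.le, le_rfl⟩ h
    · exact hanti ⟨le_rfl, h2.le⟩ ⟨h.le, ht.2⟩ h
  have hK : IsCompact (Set.Icc (-1 : ℝ) 1 ∩ {t | δ ≤ |t - m|}) :=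
    isCompact_Icc.inter_right (isClosed_le continuous_const (by fun_prop))
  obtain ⟨c, hc, hle⟩ := hK.exists_forall_le' (a := 0) hcont.neg.continuousOn fun t ht =>
    neg_pos.2 (hneg t (abs_le.2 ht.1) fun h => by
      have := ht.2
      simp only [h, Set.mem_ofPred_eq, sub_self, abs_zero] at this
      linarith)
  refine ⟨c, hc, fun t ht htm => ?_⟩
  have : c ≤ -f t := hle t ⟨abs_le.1 ht, htm⟩
  linarith

/-- Lower Laplace bound, by a change of measure to the product weight of mean `m`, which
concentrates on magnetizations near `m`. -/
lemma eventually_le_expMass {g : ℝ → ℝ} (hg : Continuous g) {m δ κ : ℝ} (h1 : -1 < m)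
    (h2 : m < 1) (hδ : 0 < δ) (hκ : 0 < κ) :
    ∀ᶠ n : ℕ in atTop, Real.exp (n * (g m + H 0 2 m - κ)) ≤
      expMass g n {x | |avg x - m| < δ} := by
  have hcont : Continuous fun t => g t - logWeight m t := hg.sub (continuous_logWeight m)
  obtain ⟨ρ, hρ, hball⟩ := Metric.continuousAt_iff.1 (hcont.continuousAt (x := m)) (κ / 2)
    (by positivity)
  obtain ⟨c, hc, hcle⟩ := exists_logWeight_add_H_le h1 h2 (lt_min hδ hρ)
  filter_upwards [eventually_succ_mul_exp_lt hc (show (0 : ℝ) < 1 / 2 by norm_num),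
    eventually_succ_le_exp (show 0 < κ / 2 by positivity), eventually_ge_atTop 1]
    with n hn hn2 hn1
  have hn1' : (1 : ℝ) ≤ n := by exact_mod_cast hn1
  set B : Set (Config n) := {x | |avg x - m| < min δ ρ}
  have hw : ∀ x : Config n, ∏ i, (1 + m * spin x i) = Real.exp (n * logWeight m (avg x)) := by
    intro x
    refine prod_one_add_eq_exp x fun i => ?_
    rcases spin_eq_or x i with h | h <;> rw [h] <;> linarith
  have htot : expMass (logWeight m) n Set.univ = 1 := by
    unfold expMass
    simp only [Set.indicator_univ, ← hw, sum_prod_one_add]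
    exact inv_mul_cancel₀ (by positivity)
  have hcompl : expMass (logWeight m) n Bᶜ < 1 / 2 := by
    refine (expMass_le _ _ (-c) fun x hx => hcle _ (abs_avg_le_one x) ?_).trans_lt ?_
    · exact not_lt.1 hx
    · rwa [mul_neg]
  have hB : 1 / 2 ≤ expMass (logWeight m) n B := by
    have := expMass_compl (logWeight m) B
    linarith
  have hstep : Real.exp (n * (g m + H 0 2 m - κ / 2)) * expMass (logWeight m) n B ≤
      expMass g n B := by
    unfold expMass
    rw [mul_left_comm, Finset.mul_sum]
    gcongr with x
    by_cases hx : x ∈ B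
    · rw [Set.indicator_of_mem hx, Set.indicator_of_mem hx, ← Real.exp_add, Real.exp_le_exp,
        ← mul_add]
      gcongr
      have hd := hball (x := avg x) (by
        rw [Real.dist_eq]; exact (show |avg x - m| < min δ ρ from hx).trans_le (min_le_right _ _))
      rw [Real.dist_eq, logWeight_self] at hd
      have := (abs_lt.1 hd).1
      linarith
    · rw [Set.indicator_of_notMem hx, Set.indicator_of_notMem hx, mul_zero]
  have hexp : Real.exp (n * (g m + H 0 2 m - κ)) ≤
      Real.exp (n * (g m + H 0 2 m - κ / 2)) * (1 / 2) := by
    have e : (n : ℝ) * (g m + H 0 2 m - κ / 2) = n * (g m + H 0 2 m - κ) + n * (κ / 2) := by ring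
    rw [e, Real.exp_add, mul_assoc]
    refine le_mul_of_one_le_right (Real.exp_pos _).le ?_
    linarith
  calc _ ≤ _ := hexp
    _ ≤ Real.exp (n * (g m + H 0 2 m - κ / 2)) * expMass (logWeight m) n B := by gcongr
    _ ≤ expMass g n B := hstep
    _ ≤ _ := expMass_mono _ fun x hx =>
      (show |avg x - m| < min δ ρ from hx).trans_le (min_le_left _ _)

/-! ### Large deviations of the magnetization under the Gibbs measure -/

/-- The Gibbs mass of `A`, normalized by the uniform distribution. -/
abbrev gibbsMass (β : ℝ) (n : ℕ) (A : Set (Config n)) : ℝ :=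
  expMass (fun t => β * t ^ 2) n A

lemma H_eq_add (β t : ℝ) : β * t ^ 2 + H 0 2 t = H β 2 t := by
  unfold H; ring

lemma mul_hamiltonian_two (β : ℝ) {n : ℕ} (x : Config n) :
    β * hamiltonian 2 n x = n * (β * avg x ^ 2) := by
  rw [hamiltonian_two]; ring

lemma partitionZ_two (β : ℝ) (n : ℕ) : partitionZ β 2 n = gibbsMass β n Set.univ := by
  unfold partitionZ gibbsMass expMass
  simp only [mul_hamiltonian_two, Set.indicator_univ]

lemma prob_two (β : ℝ) {n : ℕ} (A : Set (Config n)) :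
    prob β 2 n A = gibbsMass β n A / gibbsMass β n Set.univ := by
  have e : ∀ x : Config n, A.indicator (pmf β 2 n) x =
      A.indicator (fun x => Real.exp (n * (β * avg x ^ 2))) x /
        (2 ^ n * gibbsMass β n Set.univ) := by
    intro x
    by_cases hx : x ∈ A
    · simp only [Set.indicator_of_mem hx, pmf, mul_hamiltonian_two, partitionZ_two]
    · simp [Set.indicator_of_notMem hx]
  unfold prob
  rw [Finset.sum_congr rfl fun x _ => e x, ← Finset.sum_div]
  have h1 := (expMass_univ_pos (fun t => β * t ^ 2) n).ne'
  conv_rhs => rw [gibbsMass, expMass]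
  field_simp

lemma prob_mono (β : ℝ) {n : ℕ} {A B : Set (Config n)} (h : A ⊆ B) :
    prob β 2 n A ≤ prob β 2 n B := by
  rw [prob_two, prob_two]
  exact div_le_div_of_nonneg_right (expMass_mono _ h) (expMass_univ_pos _ n).le

lemma prob_compl (β : ℝ) {n : ℕ} (A : Set (Config n)) : 1 - prob β 2 n A = prob β 2 n Aᶜ := by
  have h := expMass_univ_pos (fun t => β * t ^ 2) n
  rw [prob_two, prob_two, eq_div_iff h.ne', sub_mul, div_mul_cancel₀ _ h.ne', one_mul,
    ← expMass_compl _ A, add_sub_cancel_left]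

lemma prob_nonneg (β : ℝ) {n : ℕ} (A : Set (Config n)) : 0 ≤ prob β 2 n A := by
  have h : expMass (fun t => β * t ^ 2) n ∅ ≤ expMass (fun t => β * t ^ 2) n A :=
    expMass_mono _ (Set.empty_subset A)
  rw [prob_two]
  exact div_nonneg (le_trans (by simp [expMass]) h) (expMass_univ_pos _ n).le

lemma prob_le_one (β : ℝ) {n : ℕ} (A : Set (Config n)) : prob β 2 n A ≤ 1 := by
  have := prob_nonneg β Aᶜ
  rw [← prob_compl] at this
  linarith

/-- Exponential upper bound for events on which `H` is at most `M`, uniform in the event. -/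
lemma eventually_prob_le {m₀ κ M : ℝ} (h0 : 0 < m₀) (h1 : m₀ < 1) (hκ : 0 < κ) :
    ∀ᶠ n : ℕ in atTop, ∀ A : Set (Config n), (∀ x ∈ A, H (betaOf m₀) 2 (avg x) ≤ M) →
      prob (betaOf m₀) 2 n A ≤ Real.exp (n * (M - H (betaOf m₀) 2 m₀ + κ)) := by
  filter_upwards [eventually_le_expMass (g := fun t => betaOf m₀ * t ^ 2) (by fun_prop)
    (show -1 < m₀ by linarith) h1 one_pos (half_pos hκ),
    eventually_succ_le_exp (half_pos hκ)] with n hlow hn A hA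
  rw [H_eq_add] at hlow
  have hup : gibbsMass (betaOf m₀) n A ≤ (n + 1) * Real.exp (n * M) :=
    expMass_le _ _ M fun x hx => by rw [H_eq_add]; exact hA x hx
  have hlow' := hlow.trans (expMass_mono _ (Set.subset_univ _))
  rw [prob_two, div_le_iff₀ (expMass_univ_pos _ n)]
  calc _ ≤ _ := hup
    _ ≤ Real.exp (n * (κ / 2)) * Real.exp (n * M) := by gcongr
    _ = Real.exp (n * (M - H (betaOf m₀) 2 m₀ + κ)) *
        Real.exp (n * (H (betaOf m₀) 2 m₀ - κ / 2)) := by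
      rw [← Real.exp_add, ← Real.exp_add]; ring_nf
    _ ≤ _ := by gcongr

/-- Exponential lower bound for events that contain all magnetizations near `t`. -/
lemma eventually_le_prob {m₀ t δ κ : ℝ} (h0 : 0 < m₀) (h1 : m₀ < 1) (ht0 : -1 < t) (ht1 : t < 1)
    (hδ : 0 < δ) (hκ : 0 < κ) :
    ∀ᶠ n : ℕ in atTop, ∀ A : Set (Config n), (∀ x : Config n, |avg x - t| < δ → x ∈ A) →
      Real.exp (n * (H (betaOf m₀) 2 t - H (betaOf m₀) 2 m₀ - κ)) ≤
        prob (betaOf m₀) 2 n A := by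
  filter_upwards [eventually_le_expMass (g := fun t => betaOf m₀ * t ^ 2) (by fun_prop)
    ht0 ht1 hδ (half_pos hκ), eventually_succ_le_exp (half_pos hκ)] with n hlow hn A hA
  rw [H_eq_add] at hlow
  have hup : gibbsMass (betaOf m₀) n Set.univ ≤ (n + 1) * Real.exp (n * H (betaOf m₀) 2 m₀) :=
    expMass_le _ _ _ fun x _ => by rw [H_eq_add]; exact H_le_max h0 h1 (abs_avg_le_one x)
  rw [prob_two, le_div_iff₀ (expMass_univ_pos _ n)]
  calc _ ≤ Real.exp (n * (H (betaOf m₀) 2 t - H (betaOf m₀) 2 m₀ - κ)) *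
        (Real.exp (n * (κ / 2)) * Real.exp (n * H (betaOf m₀) 2 m₀)) := by
        gcongr; exact hup.trans (by gcongr)
    _ = Real.exp (n * (H (betaOf m₀) 2 t - κ / 2)) := by
      rw [← Real.exp_add, ← Real.exp_add]; ring_nf
    _ ≤ _ := hlow
    _ ≤ _ := expMass_mono _ hA

/-- Under the Gibbs measure, `|x̄|` concentrates at the positive maximizer of `H`. -/
lemma tendsto_prob_abs_avg {m δ : ℝ} (h0 : 0 < m) (h1 : m < 1) (hδ : 0 < δ) :
    Tendsto (fun n : ℕ => prob (betaOf m) 2 n {x | |(|avg x| - m)| < δ}) atTop (𝓝 1) := by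
  obtain ⟨M, hM, hle⟩ : ∃ M < H (betaOf m) 2 m, ∀ t, |t| ≤ 1 → δ ≤ |(|t| - m)| →
      H (betaOf m) 2 t ≤ M := by
    have hK : IsCompact (Set.Icc (-1 : ℝ) 1 ∩ {t | δ ≤ |(|t| - m)|}) :=
      isCompact_Icc.inter_right (isClosed_le continuous_const (by fun_prop))
    obtain ⟨M, hM, hle⟩ := hK.exists_forall_le' (a := -H (betaOf m) 2 m)
      (continuous_H (betaOf m)).neg.continuousOn fun t ht =>
        neg_lt_neg (H_lt_of_abs_ne h0 h1 (abs_le.2 ht.1) fun h => by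
          have := ht.2
          simp only [h, Set.mem_ofPred_eq, sub_self, abs_zero] at this
          linarith)
    exact ⟨-M, by linarith, fun t ht htm => le_neg_of_le_neg (hle t ⟨abs_le.1 ht, htm⟩)⟩
  set c := (H (betaOf m) 2 m - M) / 2 with hc
  have hcpos : 0 < c := by rw [hc]; linarith
  have hzero : Tendsto (fun n : ℕ => prob (betaOf m) 2 n {x | |(|avg x| - m)| < δ}ᶜ)
      atTop (𝓝 0) := by
    have hexp : Tendsto (fun n : ℕ => Real.exp (-c) ^ n) atTop (𝓝 0) :=
      tendsto_pow_atTop_nhds_zero_of_lt_one (Real.exp_pos _).le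
        (Real.exp_lt_one_iff.2 (by linarith))
    refine tendsto_of_tendsto_of_tendsto_of_le_of_le' tendsto_const_nhds hexp
      (Eventually.of_forall fun n => prob_nonneg _ _) ?_
    filter_upwards [eventually_prob_le (M := M) h0 h1 hcpos] with n hn
    refine (hn _ fun x hx => hle _ (abs_avg_le_one x) ?_).trans ?_
    · simpa using hx
    · rw [← Real.exp_nat_mul, Real.exp_le_exp]
      have : M - H (betaOf m) 2 m + c = -c := by rw [hc]; ring
      rw [this]
  have := hzero.const_sub 1
  rw [sub_zero] at this
  refine this.congr fun n => ?_
  rw [prob_compl, compl_compl]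

/-! ### Bahadur slopes of estimators that order configurations by `|x̄|` -/

/-- The test statistic is a strictly increasing function of the estimator, also at `±∞`. -/
lemma strictMono_scale_sub {r : ℝ} (hr : 0 < r) (c : ℝ) :
    StrictMono fun a : EReal => (r : EReal) * (a - (c : EReal)) := by
  intro a b hab
  induction a with
  | bot =>
    have hbot : (r : EReal) * (⊥ - (c : EReal)) = ⊥ := by
      rw [EReal.bot_sub, EReal.coe_mul_bot_of_pos hr]
    simp only [hbot]
    induction b with
    | bot => exact absurd hab (lt_irrefl _)
    | coe b =>
      rw [← EReal.coe_sub, ← EReal.coe_mul]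
      exact EReal.bot_lt_coe _
    | top =>
      rw [EReal.top_sub_coe, EReal.coe_mul_top_of_pos hr]
      exact bot_lt_top
  | coe a =>
    induction b with
    | bot => exact absurd hab not_lt_bot
    | coe b =>
      simp only [← EReal.coe_sub, ← EReal.coe_mul]
      rw [EReal.coe_lt_coe_iff] at hab ⊢
      gcongr
    | top =>
      simp only [← EReal.coe_sub, ← EReal.coe_mul, EReal.top_sub_coe,
        EReal.coe_mul_top_of_pos hr]
      exact EReal.coe_lt_top _
  | top => exact absurd hab not_top_lt

lemma pValue_eq (est : (n : ℕ) → Config n → EReal) (β₀ : ℝ) {n : ℕ} (hn : 1 ≤ n)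
    (x : Config n) : pValue est 2 β₀ n x = prob β₀ 2 n {y | est n x < est n y} := by
  unfold pValue
  rw [prob_compl]
  congr 1
  ext y
  have hr : 0 < Real.sqrt n := Real.sqrt_pos.2 (by exact_mod_cast hn)
  have h := (strictMono_scale_sub hr β₀).le_iff_le (a := est n y) (b := est n x)
  simp only [Set.mem_compl_iff, Set.mem_ofPred_eq, testStat, h, not_le]

/-- An estimator that, for large `n`, ranks configurations according to `|x̄|`, up to arbitrarily
small errors in `|x̄|`. -/
def RanksByAbsAvg (est : (n : ℕ) → Config n → EReal) : Prop :=
  ∀ s t : ℝ, 0 < s → s < t → t < 1 →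
    ∀ᶠ n : ℕ in atTop, ∀ x y : Config n, |avg x| ≤ s → t ≤ |avg y| → est n x < est n y

/-- If `est` ranks by `|x̄|`, the p-value at a typical configuration of the alternative is, on the
exponential scale, the null probability that `|x̄|` exceeds the magnetization `m` of the
alternative. -/
theorem RanksByAbsAvg.isBahadurSlope {est : (n : ℕ) → Config n → EReal}
    (hest : RanksByAbsAvg est) {m₀ m : ℝ} (h0 : 0 < m₀) (h1 : m < 1) (hm : m₀ < m) :
    IsBahadurSlope est 2 (betaOf m₀) (betaOf m)
      (2 * (H (betaOf m₀) 2 m₀ - H (betaOf m₀) 2 m)) := by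
  intro ε hε
  have hm0 : 0 < m := h0.trans hm
  have hm01 : m₀ < 1 := hm.trans h1
  obtain ⟨ρ, hρ, hball⟩ := Metric.continuousAt_iff.1
    ((continuous_H (betaOf m₀)).continuousAt (x := m)) (ε / 4) (by positivity)
  obtain ⟨η, hη, hηρ, hηm, hη1⟩ : ∃ η, 0 < η ∧ 3 * η < ρ ∧ m₀ < m - 3 * η ∧ m + 3 * η < 1 := by
    refine ⟨min ρ (min (m - m₀) (1 - m)) / 4, ?_, ?_, ?_, ?_⟩
    · have : 0 < min ρ (min (m - m₀) (1 - m)) :=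
        lt_min hρ (lt_min (by linarith) (by linarith))
      linarith
    · have := min_le_left ρ (min (m - m₀) (1 - m))
      linarith
    · have := (min_le_right ρ _).trans (min_le_left (m - m₀) (1 - m))
      linarith
    · have := (min_le_right ρ _).trans (min_le_right (m - m₀) (1 - m))
      linarith
  have hlo : H (betaOf m₀) 2 (m - 2 * η) < H (betaOf m₀) 2 m + ε / 4 := by
    have := hball (x := m - 2 * η) (by rw [Real.dist_eq, abs_lt]; constructor <;> linarith)
    rw [Real.dist_eq] at this
    linarith [(abs_lt.1 this).2]
  have hhi : H (betaOf m₀) 2 m - ε / 4 < H (betaOf m₀) 2 (m + 3 * η) := by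
    have := hball (x := m + 3 * η) (by rw [Real.dist_eq, abs_lt]; constructor <;> linarith)
    rw [Real.dist_eq] at this
    linarith [(abs_lt.1 this).1]
  have hanti := strictAntiOn_H h0 hm01
  refine tendsto_of_tendsto_of_tendsto_of_le_of_le' (tendsto_prob_abs_avg hm0 h1 hη)
    tendsto_const_nhds ?_ (Eventually.of_forall fun n => prob_le_one _ _)
  filter_upwards [eventually_ge_atTop 1,
    hest (m - 2 * η) (m - η) (by linarith) (by linarith) (by linarith),
    hest (m + η) (m + 2 * η) (by linarith) (by linarith) (by linarith),
    eventually_prob_le (M := H (betaOf m₀) 2 (m - 2 * η)) h0 hm01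
      (show 0 < ε / 8 by positivity),
    eventually_le_prob (t := m + 3 * η) h0 hm01 (by linarith) hη1 hη
      (show 0 < ε / 8 by positivity)] with n hn hbelow habove hup hlow
  refine prob_mono _ fun x hx => ?_
  have hx' := abs_lt.1 (show |(|avg x| - m)| < η from hx)
  have hn' : (0 : ℝ) < n := by exact_mod_cast hn
  have hpup : pValue est 2 (betaOf m₀) n x ≤
      Real.exp (n * (H (betaOf m₀) 2 (m - 2 * η) - H (betaOf m₀) 2 m₀ + ε / 8)) := by
    rw [pValue_eq est _ hn]
    refine hup _ fun y hy => ?_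
    have hlt : m - 2 * η < |avg y| := by
      by_contra! hle
      exact lt_asymm (hbelow y x hle (by linarith)) hy
    rw [← H_abs]
    exact (hanti ⟨by linarith, by linarith⟩ ⟨by linarith, abs_avg_le_one y⟩ hlt).le
  have hplow : Real.exp (n * (H (betaOf m₀) 2 (m + 3 * η) - H (betaOf m₀) 2 m₀ - ε / 8)) ≤
      pValue est 2 (betaOf m₀) n x := by
    rw [pValue_eq est _ hn]
    refine hlow _ fun y hy => habove x y (by linarith) ?_
    have := (abs_lt.1 hy).1
    exact le_trans (by linarith) (le_abs_self (avg y))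
  have hpos : 0 < pValue est 2 (betaOf m₀) n x := (Real.exp_pos _).trans_le hplow
  have hlogup := (Real.log_le_iff_le_exp hpos).2 hpup
  have hloglow := (Real.le_log_iff_exp_le hpos).2 hplow
  refine ⟨hpos, ?_⟩
  rw [abs_lt]
  have hup' := (inv_mul_le_iff₀ hn').2 hlogup
  have hlow' := (le_inv_mul_iff₀ hn').2 hloglow
  constructor <;> linarith

lemma ranksByAbsAvg_mple : RanksByAbsAvg (mple 2) := fun _ _ _ hst _ =>
  Eventually.of_forall fun _ _ y hx hy =>
    eta_lt_eta (abs_avg_le_one y) ((hx.trans_lt hst).trans_le hy)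

/-! ### Maximizers over the extended real line -/

/-- A convex function on the line attains its minimum or is monotone. -/
lemma exists_min_or_monotone_or_antitone {D : ℝ → ℝ} (hD : ConvexOn ℝ Set.univ D) :
    (∃ r, ∀ s, D r ≤ D s) ∨ Monotone D ∨ Antitone D := by
  by_contra! hcon
  obtain ⟨hmin, hmono, hanti⟩ := hcon
  simp only [Monotone, Antitone, not_forall, not_le] at hmono hanti
  obtain ⟨a, b, hab, hDab⟩ := hmono
  obtain ⟨c, d, hcd, hDcd⟩ := hanti
  have hab' : a < b := lt_of_le_of_ne hab (by rintro rfl; exact lt_irrefl _ hDab)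
  have hcd' : c < d := lt_of_le_of_ne hcd (by rintro rfl; exact lt_irrefl _ hDcd)
  have hleft : ∀ x ≤ a, D a ≤ D x := by
    intro x hx
    by_contra! h
    have hxa : x < a := lt_of_le_of_ne hx (by rintro rfl; exact lt_irrefl _ h)
    have := hD.lt_right_of_left_lt (Set.mem_univ x) (Set.mem_univ b)
      (show a ∈ openSegment ℝ x b by rw [openSegment_eq_Ioo (hxa.trans hab')]; exact ⟨hxa, hab'⟩) h
    linarith
  have hright : ∀ x, d ≤ x → D d ≤ D x := by
    intro x hx
    by_contra! h
    have hxa : d < x := lt_of_le_of_ne hx (by rintro rfl; exact lt_irrefl _ h)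
    have := hD.lt_left_of_right_lt (Set.mem_univ c) (Set.mem_univ x)
      (show d ∈ openSegment ℝ c x by rw [openSegment_eq_Ioo (hcd'.trans hxa)]; exact ⟨hcd', hxa⟩) h
    linarith
  have hcont : Continuous D := by
    rw [← continuousOn_univ]
    exact hD.continuousOn isOpen_univ
  obtain ⟨r, hr, hrmin⟩ := (isCompact_Icc (a := min a d) (b := max a d)).exists_isMinOn
    ⟨a, min_le_left _ _, le_max_left _ _⟩ hcont.continuousOn
  obtain ⟨s, hs⟩ := hmin r
  have hra : D r ≤ D a := hrmin ⟨min_le_left _ _, le_max_left _ _⟩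
  have hrd : D r ≤ D d := hrmin ⟨min_le_right _ _, le_max_right _ _⟩
  rcases le_total s a with h | h
  · linarith [hleft s h]
  · rcases le_total d s with h' | h'
    · linarith [hright s h']
    · exact absurd (hrmin (show s ∈ Set.Icc (min a d) (max a d) from
        ⟨(min_le_left _ _).trans h, h'.trans (le_max_right _ _)⟩)) (not_le.2 hs)

/-- A likelihood whose inverse is convex and bounded below has a maximizer, possibly infinite. -/
lemma isMaximizer_argMax_inv {D : ℝ → ℝ} (hD : ConvexOn ℝ Set.univ D) (h1 : ∀ b, 1 ≤ D b) :
    IsMaximizer (fun b => (D b)⁻¹) (argMax fun b => (D b)⁻¹) := by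
  have hpos : ∀ b, 0 < D b := fun b => one_pos.trans_le (h1 b)
  have hbdd : BddAbove (Set.range fun b => (D b)⁻¹) := by
    refine ⟨1, ?_⟩
    rintro _ ⟨b, rfl⟩
    exact inv_le_one_of_one_le₀ (h1 b)
  refine Classical.epsilon_spec (p := IsMaximizer fun b => (D b)⁻¹) ?_
  rcases exists_min_or_monotone_or_antitone hD with ⟨r, hr⟩ | hmono | hanti
  · exact ⟨r, Or.inl ⟨r, rfl, fun s => inv_anti₀ (hpos r) (hr s)⟩⟩
  · have : Antitone fun b => (D b)⁻¹ := fun b c h => inv_anti₀ (hpos b) (hmono h)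
    exact ⟨⊥, Or.inr (Or.inr ⟨rfl, _, tendsto_atBot_ciSup this hbdd, fun s => le_ciSup hbdd s⟩)⟩
  · have : Monotone fun b => (D b)⁻¹ := fun b c h => inv_anti₀ (hpos c) (hanti h)
    exact ⟨⊤, Or.inr (Or.inl ⟨rfl, _, tendsto_atTop_ciSup this hbdd, fun s => le_ciSup hbdd s⟩)⟩

/-- If the likelihood decreases from `b` to `c`, the maximizer lies below `c`, since by convexity
of `D` the likelihood stays below its value at `b` beyond `c`. -/
lemma argMax_inv_lt {D : ℝ → ℝ} (hD : ConvexOn ℝ Set.univ D) (h1 : ∀ b, 1 ≤ D b)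
    {b c : ℝ} (hbc : b < c) (hlt : D b < D c) : (argMax fun b => (D b)⁻¹) < (c : EReal) := by
  have hpos : ∀ b, 0 < D b := fun b => one_pos.trans_le (h1 b)
  have hge : ∀ x, c ≤ x → D c ≤ D x := by
    intro x hx
    by_contra! h
    have hcx : c < x := lt_of_le_of_ne hx (by rintro rfl; exact lt_irrefl _ h)
    have := hD.lt_left_of_right_lt (Set.mem_univ b) (Set.mem_univ x)
      (show c ∈ openSegment ℝ b x by rw [openSegment_eq_Ioo (hbc.trans hcx)]; exact ⟨hbc, hcx⟩) h
    linarith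
  rcases isMaximizer_argMax_inv hD h1 with ⟨r, hr, hmax⟩ | ⟨-, l, hl, hmax⟩ | ⟨hr, -⟩
  · rw [hr, EReal.coe_lt_coe_iff]
    by_contra! hcr
    have := (inv_le_inv₀ (hpos b) (hpos r)).1 (hmax b)
    linarith [hge r hcr]
  · have : l ≤ (D c)⁻¹ := by
      refine le_of_tendsto hl ?_
      filter_upwards [eventually_ge_atTop c] with x hx
      exact inv_anti₀ (hpos c) (hge x hx)
    have h2 := (hmax b).trans this
    rw [inv_le_inv₀ (hpos b) (hpos c)] at h2
    linarith
  · rw [hr]; exact EReal.bot_lt_coe c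

/-- If the likelihood increases from `b` to `c`, the maximizer lies above `b`. -/
lemma lt_argMax_inv {D : ℝ → ℝ} (hD : ConvexOn ℝ Set.univ D) (h1 : ∀ b, 1 ≤ D b)
    {b c : ℝ} (hbc : b < c) (hlt : D c < D b) : (b : EReal) < argMax fun b => (D b)⁻¹ := by
  have hpos : ∀ b, 0 < D b := fun b => one_pos.trans_le (h1 b)
  have hge : ∀ x ≤ b, D b ≤ D x := by
    intro x hx
    by_contra! h
    have hxb : x < b := lt_of_le_of_ne hx (by rintro rfl; exact lt_irrefl _ h)
    have := hD.lt_right_of_left_lt (Set.mem_univ x) (Set.mem_univ c)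
      (show b ∈ openSegment ℝ x c by rw [openSegment_eq_Ioo (hxb.trans hbc)]; exact ⟨hxb, hbc⟩) h
    linarith
  rcases isMaximizer_argMax_inv hD h1 with ⟨r, hr, hmax⟩ | ⟨hr, -⟩ | ⟨-, l, hl, hmax⟩
  · rw [hr, EReal.coe_lt_coe_iff]
    by_contra! hcr
    have := (inv_le_inv₀ (hpos c) (hpos r)).1 (hmax c)
    linarith [hge r hcr]
  · rw [hr]; exact EReal.coe_lt_top b
  · have : l ≤ (D b)⁻¹ := by
      refine le_of_tendsto hl ?_
      filter_upwards [eventually_le_atBot b] with x hx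
      exact inv_anti₀ (hpos b) (hge x hx)
    have h2 := (hmax c).trans this
    rw [inv_le_inv₀ (hpos c) (hpos b)] at h2
    linarith

lemma convexOn_exp_mul (a : ℝ) : ConvexOn ℝ Set.univ fun b : ℝ => Real.exp (b * a) := by
  have h := convexOn_exp.comp_linearMap (LinearMap.mulRight ℝ a)
  exact h

lemma convexOn_sum_exp_mul {ι : Type*} (t : Finset ι) (a : ι → ℝ) :
    ConvexOn ℝ Set.univ fun b : ℝ => ∑ i ∈ t, Real.exp (b * a i) := by
  classical
  induction t using Finset.induction_on with
  | empty => simpa using convexOn_const (0 : ℝ) convex_univ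
  | insert i t hi ih =>
    simp only [Finset.sum_insert hi]
    exact (convexOn_exp_mul (a i)).add ih

/-! ### The maximum likelihood estimator -/

/-- The inverse of the likelihood of `x`, as a function of the inverse temperature. -/
def invLikelihood {n : ℕ} (x : Config n) (β : ℝ) : ℝ :=
  ∑ y : Config n, Real.exp (β * (hamiltonian 2 n y - hamiltonian 2 n x))

lemma invLikelihood_eq {n : ℕ} (x : Config n) (β : ℝ) :
    invLikelihood x β =
      2 ^ n * gibbsMass β n Set.univ * Real.exp (-(n * (β * avg x ^ 2))) := by
  rw [← partitionZ_two, partitionZ, mul_inv_cancel_left₀ (by positivity), Finset.sum_mul]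
  unfold invLikelihood
  refine Finset.sum_congr rfl fun y _ => ?_
  rw [← Real.exp_add, ← mul_hamiltonian_two]
  ring_nf

lemma pmf_eq_inv {n : ℕ} (x : Config n) (β : ℝ) : pmf β 2 n x = (invLikelihood x β)⁻¹ := by
  rw [invLikelihood_eq, Real.exp_neg, mul_inv, inv_inv, pmf, partitionZ_two,
    mul_hamiltonian_two, div_eq_inv_mul]

lemma one_le_invLikelihood {n : ℕ} (x : Config n) (β : ℝ) : 1 ≤ invLikelihood x β := by
  have h := Finset.single_le_sum
    (f := fun y : Config n => Real.exp (β * (hamiltonian 2 n y - hamiltonian 2 n x)))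
    (fun y _ => (Real.exp_pos _).le) (Finset.mem_univ x)
  simpa [invLikelihood] using h

lemma mle_eq {n : ℕ} (x : Config n) : mle 2 n x = argMax fun β => (invLikelihood x β)⁻¹ := by
  unfold mle
  simp only [pmf_eq_inv]

/-- Comparison of likelihoods at `b = betaOf m` and `c`: by convexity of the limiting free energy,
`b` is more likely than `c` for configurations with `x̄ ^ 2` on the other side of `m ^ 2`. -/
lemma eventually_invLikelihood_lt {m γ : ℝ} (c : ℝ) (h0 : 0 < m) (h1 : m < 1) (hγ : 0 < γ) :
    ∀ᶠ n : ℕ in atTop, ∀ x : Config n, γ ≤ (c - betaOf m) * (m ^ 2 - avg x ^ 2) →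
      invLikelihood x (betaOf m) < invLikelihood x c := by
  filter_upwards [eventually_le_expMass (g := fun t => c * t ^ 2) (by fun_prop)
    (show -1 < m by linarith) h1 one_pos (half_pos hγ),
    eventually_succ_mul_exp_lt (half_pos hγ) one_pos] with n hlow hn x hx
  rw [H_eq_add] at hlow
  have hup : gibbsMass (betaOf m) n Set.univ ≤ (n + 1) * Real.exp (n * H (betaOf m) 2 m) :=
    expMass_le _ _ _ fun x _ => by rw [H_eq_add]; exact H_le_max h0 h1 (abs_avg_le_one x)
  have hsucc : (n : ℝ) + 1 < Real.exp (n * (γ / 2)) := by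
    rw [Real.exp_neg, mul_inv_lt_iff₀ (Real.exp_pos _), one_mul] at hn
    exact hn
  rw [invLikelihood_eq, invLikelihood_eq, mul_assoc, mul_assoc]
  refine mul_lt_mul_of_pos_left ?_ (by positivity)
  calc _ ≤ (n + 1) * Real.exp (n * H (betaOf m) 2 m) *
        Real.exp (-(n * (betaOf m * avg x ^ 2))) := by gcongr
    _ < Real.exp (n * (γ / 2)) * Real.exp (n * H (betaOf m) 2 m) *
        Real.exp (-(n * (betaOf m * avg x ^ 2))) := by gcongr
    _ ≤ Real.exp (n * (H c 2 m - γ / 2)) * Real.exp (-(n * (c * avg x ^ 2))) := by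
        rw [← Real.exp_add, ← Real.exp_add, ← Real.exp_add, Real.exp_le_exp]
        have hs := H_sub c (betaOf m) m
        have : (n : ℝ) * γ ≤ n * ((c - betaOf m) * (m ^ 2 - avg x ^ 2)) := by gcongr
        have e : H c 2 m = H (betaOf m) 2 m + (c - betaOf m) * m ^ 2 := by linarith
        rw [e]
        linarith
    _ ≤ _ := by
        gcongr
        exact hlow.trans (expMass_mono _ (Set.subset_univ _))

lemma ranksByAbsAvg_mle : RanksByAbsAvg (mle 2) := by
  intro s t hs hst ht
  obtain ⟨m₁, hsm₁, hm₁⟩ := exists_between hst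
  obtain ⟨m₃, hm₁₃, hm₃t⟩ := exists_between hm₁
  have hb := strictMonoOn_betaOf (a := m₁) (b := m₃) ⟨by linarith, by linarith⟩
    ⟨by linarith, by linarith⟩ hm₁₃
  obtain ⟨c, hc₁, hc₃⟩ := exists_between hb
  have hγ₁ : 0 < (c - betaOf m₁) * (m₁ ^ 2 - s ^ 2) := by
    apply mul_pos <;> nlinarith
  have hγ₃ : 0 < (c - betaOf m₃) * (m₃ ^ 2 - t ^ 2) := by
    apply mul_pos_of_neg_of_neg <;> nlinarith
  filter_upwards [eventually_invLikelihood_lt (m := m₁) c (by linarith) (by linarith) hγ₁,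
    eventually_invLikelihood_lt (m := m₃) c (by linarith) (by linarith) hγ₃]
    with n hn₁ hn₃ x y hx hy
  have hx2 : avg x ^ 2 ≤ s ^ 2 := by
    rw [← sq_abs]; gcongr
  have hy2 : t ^ 2 ≤ avg y ^ 2 := by
    rw [← sq_abs (avg y)]
    have : 0 < t := hs.trans hst
    gcongr
  rw [mle_eq, mle_eq]
  refine (argMax_inv_lt (convexOn_sum_exp_mul _ _) (one_le_invLikelihood x) hc₁
    (hn₁ x ?_)).trans (lt_argMax_inv (convexOn_sum_exp_mul _ _) (one_le_invLikelihood y) hc₃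
    (hn₃ y ?_))
  · exact mul_le_mul_of_nonneg_left (by linarith) (by linarith)
  · exact mul_le_mul_of_nonpos_left (by linarith) (by linarith)

/-! ### The exact maximum pseudolikelihood estimator -/

/-- The change of the sufficient statistic when the `i`-th spin is flipped. -/
def flipCost {n : ℕ} (x : Config n) (i : Fin n) : ℝ := 4 * ((n : ℝ)⁻¹ - avg x * spin x i)

/-- The inverse of the pseudolikelihood of `x`, as a function of the inverse temperature. -/
def invPseudolikelihood {n : ℕ} (x : Config n) (β : ℝ) : ℝ :=
  ∏ i, (1 + Real.exp (β * flipCost x i))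

lemma avg_update {n : ℕ} (x : Config n) (i : Fin n) :
    avg (Function.update x i (-x i)) = avg x - 2 * (n : ℝ)⁻¹ * spin x i := by
  have h : ∑ j, spin (Function.update x i (-x i)) j = ∑ j, spin x j - 2 * spin x i := by
    rw [← Finset.add_sum_erase _ _ (Finset.mem_univ i),
      ← Finset.add_sum_erase _ (spin x) (Finset.mem_univ i)]
    have : ∀ j ∈ Finset.univ.erase i, spin (Function.update x i (-x i)) j = spin x j := by
      intro j hj
      unfold spin
      rw [Function.update_of_ne (Finset.ne_of_mem_erase hj)]
    rw [Finset.sum_congr rfl this]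
    have hi : spin (Function.update x i (-x i)) i = -spin x i := by
      unfold spin
      rw [Function.update_self]
      push_cast
      rfl
    rw [hi]
    ring
  unfold avg
  rw [h]
  ring

lemma hamiltonian_update {n : ℕ} (x : Config n) (i : Fin n) :
    hamiltonian 2 n (Function.update x i (-x i)) = hamiltonian 2 n x + flipCost x i := by
  have hn : (n : ℝ) ≠ 0 := by exact_mod_cast (Fin.pos i).ne'
  rw [hamiltonian_two, hamiltonian_two, avg_update, flipCost]
  have hs : spin x i ^ 2 = 1 := by rcases spin_eq_or x i with h | h <;> rw [h] <;> norm_num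
  have e : (n : ℝ) * (avg x - 2 * (n : ℝ)⁻¹ * spin x i) ^ 2 =
      n * avg x ^ 2 - 4 * avg x * spin x i * (n * (n : ℝ)⁻¹) +
        4 * (n : ℝ)⁻¹ * (n * (n : ℝ)⁻¹) * spin x i ^ 2 := by ring
  rw [e, hs, mul_inv_cancel₀ hn]
  ring

lemma condProb_eq {n : ℕ} (x : Config n) (i : Fin n) (β : ℝ) :
    condProb β 2 n x i = (1 + Real.exp (β * flipCost x i))⁻¹ := by
  have hden : pmf β 2 n (Function.update x i 1) + pmf β 2 n (Function.update x i (-1)) =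
      pmf β 2 n x + pmf β 2 n (Function.update x i (-x i)) := by
    rcases Int.units_eq_one_or (x i) with h | h
    · rw [h, show Function.update x i 1 = x by rw [← h, Function.update_eq_self]]
    · rw [h, show Function.update x i (-1) = x by rw [← h, Function.update_eq_self], neg_neg,
        add_comm]
  have hflip : pmf β 2 n (Function.update x i (-x i)) =
      pmf β 2 n x * Real.exp (β * flipCost x i) := by
    unfold pmf
    rw [hamiltonian_update, mul_add, Real.exp_add]
    ring
  have hpos : pmf β 2 n x ≠ 0 := by
    rw [pmf_eq_inv]
    exact inv_ne_zero (one_pos.trans_le (one_le_invLikelihood x β)).ne'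
  rw [condProb, hden, hflip]
  have : 1 + Real.exp (β * flipCost x i) ≠ 0 := by positivity
  field_simp

lemma mpleArgMax_eq {n : ℕ} (x : Config n) :
    mpleArgMax 2 n x = argMax fun β => (invPseudolikelihood x β)⁻¹ := by
  unfold mpleArgMax invPseudolikelihood
  congr 1
  ext β
  rw [pseudolikelihood, ← Finset.prod_inv_distrib]
  exact Finset.prod_congr rfl fun i _ => condProb_eq x i β

lemma one_le_invPseudolikelihood {n : ℕ} (x : Config n) (β : ℝ) :
    1 ≤ invPseudolikelihood x β :=
  Finset.one_le_prod fun i _ => by linarith [Real.exp_pos (β * flipCost x i)]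

lemma convexOn_invPseudolikelihood {n : ℕ} (x : Config n) :
    ConvexOn ℝ Set.univ (invPseudolikelihood x) := by
  classical
  have e : invPseudolikelihood x = fun β => ∑ t ∈ (Finset.univ : Finset (Fin n)).powerset,
      Real.exp (β * ∑ i ∈ t, flipCost x i) := by
    ext β
    rw [invPseudolikelihood, Finset.prod_one_add]
    refine Finset.sum_congr rfl fun t _ => ?_
    rw [← Real.exp_sum, Finset.mul_sum]
  rw [e]
  exact convexOn_sum_exp_mul _ _

/-- Up to a factor `2n`, the derivative in `b` of the logarithm of the inverse pseudolikelihood at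
a configuration of magnetization `t`, where `r = n⁻¹`. -/
def pseudoScore (b r t : ℝ) : ℝ :=
  (1 + t) * (r - t) * (1 + Real.exp (4 * b * (t - r)))⁻¹ +
    (1 - t) * (r + t) * (1 + Real.exp (-(4 * b * (t + r))))⁻¹

lemma pseudoScore_neg (b r t : ℝ) : pseudoScore b r (-t) = pseudoScore b r t := by
  unfold pseudoScore
  rw [show 4 * b * (-t - r) = -(4 * b * (t + r)) by ring,
    show -(4 * b * (-t + r)) = 4 * b * (t - r) by ring]
  ring

lemma pseudoScore_abs (b r t : ℝ) : pseudoScore b r |t| = pseudoScore b r t := by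
  rcases abs_choice t with h | h <;> rw [h]
  exact pseudoScore_neg b r t

lemma hasDerivAt_log_invPseudolikelihood {n : ℕ} (x : Config n) (b : ℝ) :
    HasDerivAt (fun β => ∑ i, Real.log (1 + Real.exp (β * flipCost x i)))
      (2 * n * pseudoScore b (n : ℝ)⁻¹ (avg x)) b := by
  have hd : ∀ i ∈ (Finset.univ : Finset (Fin n)),
      HasDerivAt (fun β => Real.log (1 + Real.exp (β * flipCost x i)))
        (flipCost x i * (1 + Real.exp (-(b * flipCost x i)))⁻¹) b := by
    intro i _
    have h1 : HasDerivAt (fun β => 1 + Real.exp (β * flipCost x i))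
        (Real.exp (b * flipCost x i) * (1 * flipCost x i)) b :=
      (((hasDerivAt_id' b).mul_const _).exp).const_add 1
    refine (h1.log (by positivity)).congr_deriv ?_
    rw [Real.exp_neg]
    have := Real.exp_pos (b * flipCost x i)
    field_simp
    ring
  refine (HasDerivAt.fun_sum hd).congr_deriv ?_
  set φ : ℝ → ℝ := fun s => 4 * ((n : ℝ)⁻¹ - avg x * s) *
    (1 + Real.exp (-(b * (4 * ((n : ℝ)⁻¹ - avg x * s)))))⁻¹ with hφ
  have hlin : ∀ i, flipCost x i * (1 + Real.exp (-(b * flipCost x i)))⁻¹ =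
      (φ 1 + φ (-1)) / 2 + spin x i * ((φ 1 - φ (-1)) / 2) := by
    intro i
    have : flipCost x i * (1 + Real.exp (-(b * flipCost x i)))⁻¹ = φ (spin x i) := rfl
    rw [this]
    rcases spin_eq_or x i with h | h <;> rw [h] <;> ring
  rw [Finset.sum_congr rfl fun i _ => hlin i, Finset.sum_add_distrib, ← Finset.sum_mul,
    ← mul_avg]
  have e1 : φ 1 = 4 * ((n : ℝ)⁻¹ - avg x) *
      (1 + Real.exp (4 * b * (avg x - (n : ℝ)⁻¹)))⁻¹ := by
    simp only [hφ]; ring_nf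
  have e2 : φ (-1) = 4 * ((n : ℝ)⁻¹ + avg x) *
      (1 + Real.exp (-(4 * b * (avg x + (n : ℝ)⁻¹))))⁻¹ := by
    simp only [hφ]; ring_nf
  rw [e1, e2, pseudoScore]
  simp only [Finset.sum_const, Finset.card_univ, Fintype.card_fin, nsmul_eq_mul]
  ring

lemma invPseudolikelihood_eq_exp {n : ℕ} (x : Config n) (β : ℝ) :
    invPseudolikelihood x β =
      Real.exp (∑ i, Real.log (1 + Real.exp (β * flipCost x i))) := by
  rw [Real.exp_sum]
  exact Finset.prod_congr rfl fun i _ => (Real.exp_log (by positivity)).symm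

lemma exists_lt_of_hasDerivAt_pos {f : ℝ → ℝ} {f' b : ℝ} (hf : HasDerivAt f f' b)
    (hpos : 0 < f') : ∃ c < b, f c < f b := by
  have h := (hasDerivAt_iff_tendsto_slope.1 hf).mono_left
    (nhdsWithin_mono b (show Set.Iio b ⊆ {b}ᶜ from fun x hx => ne_of_lt hx))
  obtain ⟨c, hc, hcb⟩ := ((h.eventually (lt_mem_nhds hpos)).and self_mem_nhdsWithin).exists
  have hcb' : c < b := hcb
  refine ⟨c, hcb', ?_⟩
  rw [slope_def_field] at hc
  by_contra! hle
  exact absurd hc (not_lt.2 (div_nonpos_of_nonneg_of_nonpos (by linarith) (by linarith)))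

lemma exists_gt_of_hasDerivAt_neg {f : ℝ → ℝ} {f' b : ℝ} (hf : HasDerivAt f f' b)
    (hneg : f' < 0) : ∃ c > b, f c < f b := by
  have h := (hasDerivAt_iff_tendsto_slope.1 hf).mono_left
    (nhdsWithin_mono b (show Set.Ioi b ⊆ {b}ᶜ from fun x hx => ne_of_gt hx))
  obtain ⟨c, hc, hcb⟩ := ((h.eventually (gt_mem_nhds hneg)).and self_mem_nhdsWithin).exists
  have hcb' : b < c := hcb
  refine ⟨c, hcb', ?_⟩
  rw [slope_def_field] at hc
  by_contra! hle
  exact absurd hc (not_lt.2 (div_nonneg (by linarith) (by linarith)))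

/-- The sign of the score at `b` decides on which side of `b` the maximizer lies. -/
lemma mpleArgMax_lt {n : ℕ} (x : Config n) {b : ℝ} (hn : 1 ≤ n)
    (h : 0 < pseudoScore b (n : ℝ)⁻¹ |avg x|) : mpleArgMax 2 n x < (b : EReal) := by
  have hn' : (0 : ℝ) < n := by exact_mod_cast hn
  rw [pseudoScore_abs] at h
  obtain ⟨c, hc, hlt⟩ := exists_lt_of_hasDerivAt_pos (hasDerivAt_log_invPseudolikelihood x b)
    (by positivity)
  rw [mpleArgMax_eq]
  refine argMax_inv_lt (convexOn_invPseudolikelihood x) (one_le_invPseudolikelihood x) hc ?_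
  rw [invPseudolikelihood_eq_exp, invPseudolikelihood_eq_exp]
  exact Real.exp_lt_exp.2 hlt

lemma lt_mpleArgMax {n : ℕ} (x : Config n) {b : ℝ} (hn : 1 ≤ n)
    (h : pseudoScore b (n : ℝ)⁻¹ |avg x| < 0) : (b : EReal) < mpleArgMax 2 n x := by
  have hn' : (0 : ℝ) < n := by exact_mod_cast hn
  rw [pseudoScore_abs] at h
  obtain ⟨c, hc, hlt⟩ := exists_gt_of_hasDerivAt_neg (hasDerivAt_log_invPseudolikelihood x b)
    (mul_neg_of_pos_of_neg (by positivity) h)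
  rw [mpleArgMax_eq]
  refine lt_argMax_inv (convexOn_invPseudolikelihood x) (one_le_invPseudolikelihood x) hc ?_
  rw [invPseudolikelihood_eq_exp, invPseudolikelihood_eq_exp]
  exact Real.exp_lt_exp.2 hlt

/-- The numerator of `pseudoScore` over the common denominator. -/
def scoreNum (b r t : ℝ) : ℝ :=
  t * ((1 - t) * (1 + Real.exp (4 * b * (t - r))) -
      (1 + t) * (1 + Real.exp (-(4 * b * (t + r))))) +
    r * ((1 - t) * (1 + Real.exp (4 * b * (t - r))) +
      (1 + t) * (1 + Real.exp (-(4 * b * (t + r)))))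

lemma pseudoScore_eq (b r t : ℝ) :
    pseudoScore b r t = scoreNum b r t *
      ((1 + Real.exp (4 * b * (t - r)))⁻¹ * (1 + Real.exp (-(4 * b * (t + r))))⁻¹) := by
  have h1 : 1 + Real.exp (4 * b * (t - r)) ≠ 0 := by positivity
  have h2 : 1 + Real.exp (-(4 * b * (t + r))) ≠ 0 := by positivity
  unfold pseudoScore scoreNum
  field_simp
  ring

/-- The identity `exp (2 artanh t) = (1 + t) / (1 - t)`, in terms of `betaOf`. -/
lemma one_add_eq_exp {t : ℝ} (h0 : 0 < t) (h1 : t < 1) :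
    1 + t = (1 - t) * Real.exp (4 * betaOf t * t) := by
  have e : 4 * betaOf t * t = Real.log (1 + t) - Real.log (1 - t) := by
    have := artanh_eq_betaOf_mul h0
    rw [artanh_eq (by linarith) h1] at this
    linarith
  rw [e, Real.exp_sub, Real.exp_log (by linarith), Real.exp_log (by linarith)]
  have : 1 - t ≠ 0 := by linarith
  field_simp

/-- The left side is the limit of `scoreNum b r t / t` as `r → 0`. -/
lemma scoreLimit_factor (b t : ℝ) :
    (1 - t) * (1 + Real.exp (4 * b * t)) - (1 + t) * (1 + Real.exp (-(4 * b * t))) =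
      (1 + Real.exp (-(4 * b * t))) * ((1 - t) * Real.exp (4 * b * t) - (1 + t)) := by
  have h : Real.exp (-(4 * b * t)) * Real.exp (4 * b * t) = 1 := by
    rw [← Real.exp_add]; simp
  linear_combination (-(1 - t)) * h

lemma scoreLimit_pos {m t : ℝ} (h1 : m < 1) (ht0 : 0 < t) (htm : t < m) :
    0 < (1 - t) * Real.exp (4 * betaOf m * t) - (1 + t) := by
  have hlt := strictMonoOn_betaOf ⟨ht0, htm.trans h1⟩ ⟨ht0.trans htm, h1⟩ htm
  have ht1 : 0 < 1 - t := by linarith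
  rw [one_add_eq_exp ht0 (by linarith), sub_pos]
  gcongr

lemma scoreLimit_neg {m t : ℝ} (h0 : 0 < m) (htm : m < t) (ht1 : t ≤ 1) :
    (1 - t) * Real.exp (4 * betaOf m * t) - (1 + t) < 0 := by
  rcases ht1.eq_or_lt with rfl | ht1
  · norm_num
  · have hlt := strictMonoOn_betaOf ⟨h0, htm.trans ht1⟩ ⟨h0.trans htm, ht1⟩ htm
    have ht1' : 0 < 1 - t := by linarith
    have ht0 : 0 < t := h0.trans htm
    rw [one_add_eq_exp ht0 (by linarith), sub_neg]
    gcongr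

lemma eventually_inv_lt {ε : ℝ} (hε : 0 < ε) : ∀ᶠ n : ℕ in atTop, (n : ℝ)⁻¹ < ε :=
  tendsto_inv_atTop_nhds_zero_nat.eventually (gt_mem_nhds hε)

/-- Below the critical magnetization the score is positive. The limit of the score as `r → 0`
vanishes at `t = 0`, so small `t` are treated by means of the correction of order `r`. -/
lemma eventually_scoreNum_pos {m s : ℝ} (h1 : m < 1) (hs : 0 < s) (hsm : s < m) :
    ∀ᶠ n : ℕ in atTop, ∀ t, 0 ≤ t → t ≤ s → 0 < scoreNum (betaOf m) (n : ℝ)⁻¹ t := by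
  set b := betaOf m
  have hb : 0 < b := (half_lt_betaOf (hs.trans hsm) h1).trans' (by norm_num)
  set C := 4 * b * Real.exp (4 * b) with hC
  have hCpos : 0 < C := by positivity
  obtain ⟨g, hg, hgle⟩ := (isCompact_Icc (a := 1 / C) (b := s)).exists_forall_le' (a := 0)
    (f := fun t => (1 - t) * Real.exp (4 * b * t) - (1 + t))
    (Continuous.continuousOn (by fun_prop))
    fun t ht => scoreLimit_pos h1 ((by positivity : 0 < 1 / C).trans_le ht.1) (ht.2.trans_lt hsm)
  filter_upwards [eventually_inv_lt (show 0 < g / C / C by positivity), eventually_ge_atTop 1]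
    with n hn hn1 t ht0 hts
  have hr : (0 : ℝ) < (n : ℝ)⁻¹ := by
    have : (0 : ℝ) < n := by exact_mod_cast hn1
    positivity
  set r := (n : ℝ)⁻¹
  have ht1 : t < 1 := by linarith
  -- the error from replacing `r` by `0` in the exponentials
  have hP : (1 - t) * (1 + Real.exp (4 * b * t)) - C * r ≤
      (1 - t) * (1 + Real.exp (4 * b * (t - r))) := by
    have e : Real.exp (4 * b * (t - r)) = Real.exp (4 * b * t) * Real.exp (-(4 * b * r)) := by
      rw [← Real.exp_add]; ring_nf
    have hexp := Real.add_one_le_exp (-(4 * b * r))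
    have h2 : Real.exp (4 * b * t) ≤ Real.exp (4 * b) := by
      rw [Real.exp_le_exp]; nlinarith
    have h3 : Real.exp (4 * b * t) * (1 - 4 * b * r) ≤ Real.exp (4 * b * (t - r)) := by
      rw [e]; gcongr; linarith
    have h4 : (1 - t) * (Real.exp (4 * b * t) * (4 * b * r)) ≤
        1 * (Real.exp (4 * b) * (4 * b * r)) := by
      gcongr; linarith
    have h5 := mul_le_mul_of_nonneg_left h3 (show 0 ≤ 1 - t by linarith)
    rw [hC]
    linarith
  have hQ : (1 + t) * (1 + Real.exp (-(4 * b * (t + r)))) ≤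
      (1 + t) * (1 + Real.exp (-(4 * b * t))) := by
    gcongr; linarith
  have hsum : 2 ≤ (1 - t) * (1 + Real.exp (4 * b * (t - r))) +
      (1 + t) * (1 + Real.exp (-(4 * b * (t + r)))) := by
    have := mul_nonneg (show 0 ≤ 1 - t by linarith) (Real.exp_pos (4 * b * (t - r))).le
    have := mul_nonneg (show 0 ≤ 1 + t by linarith) (Real.exp_pos (-(4 * b * (t + r)))).le
    linarith
  have hfac := scoreLimit_factor b t
  have hq := Real.exp_pos (-(4 * b * t))
  have hlow : t * ((1 + Real.exp (-(4 * b * t))) *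
      ((1 - t) * Real.exp (4 * b * t) - (1 + t)) - C * r) + r * 2 ≤ scoreNum b r t := by
    exact add_le_add (mul_le_mul_of_nonneg_left (by linarith) ht0)
      (mul_le_mul_of_nonneg_left hsum hr.le)
  refine lt_of_lt_of_le ?_ hlow
  rcases le_or_gt t (1 / C) with hsmall | hlarge
  · have hG : 0 ≤ (1 - t) * Real.exp (4 * b * t) - (1 + t) := by
      rcases ht0.eq_or_lt with rfl | ht0
      · simp
      · exact (scoreLimit_pos h1 ht0 (by linarith)).le
    have h6 : t * C ≤ 1 := by rwa [le_div_iff₀ hCpos] at hsmall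
    have h7 : 0 ≤ t * ((1 + Real.exp (-(4 * b * t))) *
        ((1 - t) * Real.exp (4 * b * t) - (1 + t))) := by positivity
    have h8 : t * C * r ≤ 1 * r := by gcongr
    linarith
  · have hG : g ≤ (1 - t) * Real.exp (4 * b * t) - (1 + t) := hgle t ⟨hlarge.le, hts⟩
    have h6 : g ≤ (1 + Real.exp (-(4 * b * t))) *
        ((1 - t) * Real.exp (4 * b * t) - (1 + t)) := by
      have : 0 ≤ Real.exp (-(4 * b * t)) * ((1 - t) * Real.exp (4 * b * t) - (1 + t)) :=
        mul_nonneg hq.le (hg.le.trans hG)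
      linarith
    have h7 : 1 / C * g ≤ t * ((1 + Real.exp (-(4 * b * t))) *
        ((1 - t) * Real.exp (4 * b * t) - (1 + t))) :=
      mul_le_mul hlarge.le h6 hg.le ht0
    have h8 : r * C < g / C := by rwa [lt_div_iff₀ hCpos] at hn
    have h9 : t * (C * r) ≤ 1 * (C * r) := by gcongr
    have h10 : 1 / C * g = g / C := by ring
    linarith

/-- Above the critical magnetization the score is negative. -/
lemma eventually_scoreNum_neg {m s : ℝ} (h0 : 0 < m) (h1 : m < 1) (hms : m < s) :
    ∀ᶠ n : ℕ in atTop, ∀ t, s ≤ t → t ≤ 1 → scoreNum (betaOf m) (n : ℝ)⁻¹ t < 0 := by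
  set b := betaOf m
  have hb : 0 < b := (half_lt_betaOf h0 h1).trans' (by norm_num)
  obtain ⟨g, hg, hgle⟩ := (isCompact_Icc (a := s) (b := 1)).exists_forall_le' (a := 0)
    (f := fun t => -((1 - t) * Real.exp (4 * b * t) - (1 + t)))
    (Continuous.continuousOn (by fun_prop))
    fun t ht => neg_pos.2 (scoreLimit_neg h0 (hms.trans_le ht.1) ht.2)
  have hs : 0 < s := h0.trans hms
  set C := 8 * b + (1 + Real.exp (4 * b) + 4) with hC
  have hCpos : 0 < C := by positivity
  filter_upwards [eventually_inv_lt (show 0 < s * g / C by positivity), eventually_ge_atTop 1]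
    with n hn hn1 t hst ht1
  have hr : (0 : ℝ) < (n : ℝ)⁻¹ := by
    have : (0 : ℝ) < n := by exact_mod_cast hn1
    positivity
  set r := (n : ℝ)⁻¹
  have ht0 : 0 < t := hs.trans_le hst
  have ht1' : 0 ≤ 1 - t := by linarith
  have hP : (1 - t) * (1 + Real.exp (4 * b * (t - r))) ≤
      (1 - t) * (1 + Real.exp (4 * b * t)) := by
    gcongr; linarith
  have hP' : (1 - t) * (1 + Real.exp (4 * b * t)) ≤ 1 * (1 + Real.exp (4 * b)) := by
    have : 4 * b * t ≤ 4 * b := by nlinarith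
    gcongr
    linarith
  have hQ1 : Real.exp (-(4 * b * t)) ≤ 1 := Real.exp_le_one_iff.2 (by
    have : 0 ≤ 4 * b * t := by positivity
    linarith)
  have hQ2 : Real.exp (-(4 * b * (t + r))) ≤ 1 := Real.exp_le_one_iff.2 (by
    have : 0 ≤ 4 * b * (t + r) := by positivity
    linarith)
  -- the error from replacing `r` by `0` in the exponentials
  have hQ : (1 + t) * (1 + Real.exp (-(4 * b * t))) - 8 * b * r ≤
      (1 + t) * (1 + Real.exp (-(4 * b * (t + r)))) := by
    have e : Real.exp (-(4 * b * (t + r))) =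
        Real.exp (-(4 * b * t)) * Real.exp (-(4 * b * r)) := by
      rw [← Real.exp_add]; ring_nf
    have hexp := Real.add_one_le_exp (-(4 * b * r))
    have h3 : Real.exp (-(4 * b * t)) * (1 - 4 * b * r) ≤ Real.exp (-(4 * b * (t + r))) := by
      rw [e]; gcongr; linarith
    have h4 : (1 + t) * (Real.exp (-(4 * b * t)) * (4 * b * r)) ≤ 2 * (1 * (4 * b * r)) := by
      gcongr; linarith
    have h5 := mul_le_mul_of_nonneg_left h3 (show 0 ≤ 1 + t by linarith)
    linarith
  have hQ' : (1 + t) * (1 + Real.exp (-(4 * b * (t + r)))) ≤ 2 * (1 + 1) := by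
    gcongr; linarith
  have hfac := scoreLimit_factor b t
  have hup : scoreNum b r t ≤ t * ((1 + Real.exp (-(4 * b * t))) *
      ((1 - t) * Real.exp (4 * b * t) - (1 + t)) + 8 * b * r) +
        r * (1 + Real.exp (4 * b) + 4) := by
    exact add_le_add (mul_le_mul_of_nonneg_left (by linarith) ht0.le)
      (mul_le_mul_of_nonneg_left (by linarith) hr.le)
  refine hup.trans_lt ?_
  have hG : g ≤ -((1 - t) * Real.exp (4 * b * t) - (1 + t)) := hgle t ⟨hst, ht1⟩
  have h6 : g ≤ -((1 + Real.exp (-(4 * b * t))) *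
      ((1 - t) * Real.exp (4 * b * t) - (1 + t))) := by
    have : 0 ≤ Real.exp (-(4 * b * t)) * -((1 - t) * Real.exp (4 * b * t) - (1 + t)) :=
      mul_nonneg (Real.exp_pos _).le (hg.le.trans hG)
    linarith
  have h7 : s * g ≤ t * -((1 + Real.exp (-(4 * b * t))) *
      ((1 - t) * Real.exp (4 * b * t) - (1 + t))) := by
    gcongr
  have h8 : r * C < s * g := by rwa [lt_div_iff₀ hCpos] at hn
  have h9 : t * (8 * b * r) ≤ 1 * (8 * b * r) := by gcongr
  rw [hC] at h8
  linarith

lemma ranksByAbsAvg_mpleArgMax : RanksByAbsAvg (mpleArgMax 2) := by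
  intro s t hs hst ht
  obtain ⟨m, hsm, hmt⟩ := exists_between hst
  filter_upwards [eventually_scoreNum_pos (hmt.trans ht) hs hsm,
    eventually_scoreNum_neg (hs.trans hsm) (hmt.trans ht) hmt, eventually_ge_atTop 1]
    with n hpos hneg hn x y hx hy
  refine (mpleArgMax_lt x (b := betaOf m) hn ?_).trans (lt_mpleArgMax y hn ?_)
  · rw [pseudoScore_eq]
    exact mul_pos (hpos _ (abs_nonneg _) hx) (by positivity)
  · rw [pseudoScore_eq]
    exact mul_neg_of_neg_of_pos (hneg _ hy (abs_avg_le_one y)) (by positivity)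

end CurieWeiss

end

theorem theorem2 (β₀ β : ℝ) (hβ₀ : CurieWeiss.betaStar 2 < β₀) (hβ : β₀ < β) :
    CurieWeiss.IsBahadurSlope (CurieWeiss.mple 2) 2 β₀ β (CurieWeiss.slopeMPL β₀ β 2) ∧
    CurieWeiss.IsBahadurSlope (CurieWeiss.mpleArgMax 2) 2 β₀ β (CurieWeiss.slopeMPL β₀ β 2) ∧
    CurieWeiss.IsBahadurSlope (CurieWeiss.mle 2) 2 β₀ β (CurieWeiss.slopeML β₀ β 2) ∧
    0 < CurieWeiss.slopeMPL β₀ β 2 ∧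
    0 < CurieWeiss.slopeML β₀ β 2 ∧
    CurieWeiss.slopeMPL β₀ β 2 = CurieWeiss.slopeML β₀ β 2 ∧
    (∀ δ ∈ Set.Ioo (0 : ℝ) 1,
      CurieWeiss.optimalSampleSize δ (CurieWeiss.slopeMPL β₀ β 2) =
        CurieWeiss.optimalSampleSize δ (CurieWeiss.slopeML β₀ β 2)) ∧
    CurieWeiss.bahadurARE (CurieWeiss.slopeML β₀ β 2) (CurieWeiss.slopeMPL β₀ β 2) = 1 := by
  have hhalf := CurieWeiss.half_le_betaStar
  obtain ⟨m₀, h0, h01, rfl⟩ := CurieWeiss.exists_betaOf_eq (hhalf.trans_lt hβ₀)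
  obtain ⟨m, hm0, h1, rfl⟩ := CurieWeiss.exists_betaOf_eq ((hhalf.trans_lt hβ₀).trans hβ)
  have hm : m₀ < m :=
    (CurieWeiss.strictMonoOn_betaOf.lt_iff_lt ⟨h0, h01⟩ ⟨hm0, h1⟩).1 hβ
  have hpos : 0 < CurieWeiss.slopeML (CurieWeiss.betaOf m₀) (CurieWeiss.betaOf m) 2 := by
    rw [CurieWeiss.slopeML_betaOf h0 h1 hm]
    have := CurieWeiss.strictAntiOn_H h0 h01 ⟨le_rfl, h01.le⟩ ⟨hm.le, h1.le⟩ hm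
    linarith
  have hslope : ∀ {est : (n : ℕ) → CurieWeiss.Config n → EReal},
      CurieWeiss.RanksByAbsAvg est →
      CurieWeiss.IsBahadurSlope est 2 (CurieWeiss.betaOf m₀) (CurieWeiss.betaOf m)
        (CurieWeiss.slopeML (CurieWeiss.betaOf m₀) (CurieWeiss.betaOf m) 2) := by
    intro est hest
    rw [CurieWeiss.slopeML_betaOf h0 h1 hm]
    exact hest.isBahadurSlope h0 h1 hm
  rw [CurieWeiss.slopeMPL_eq_slopeML hm0 h1]
  exact ⟨hslope CurieWeiss.ranksByAbsAvg_mple, hslope CurieWeiss.ranksByAbsAvg_mpleArgMax,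
    hslope CurieWeiss.ranksByAbsAvg_mle, hpos, hpos, rfl, fun _ _ => rfl, div_self hpos.ne'⟩
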